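/- Let $L$ be a closed smooth manifold (compact, Hausdorff, without boundary). For $s\ge 1$ let $\Delta_{L,s}=\{(p_1,\dots,p_s)\in L^s : p_j=p_k \text{ for some } j\ne k\}$ be the big diagonal. Let $J$ be a countable index set and, for each $j\in J$, let $M_j$ be a smooth manifold (Hausdorff, second countable, without boundary), $s_j$ a positive integer, $N_j$ a smooth (embedded, not necessarily closed) submanifold of $L^{s_j}$ contained in $L^{s_j}\setminus\Delta_{L,s_j}$, and $f_j\colon M_j\to L^{s_j}$ a smooth map. Then for every neighbourhood $\mathcal U$ of $\operatorname{id}_L$ in $C^\infty(L,L)$ with its $C^\infty$-topology (uniform convergence, in charts and on compact sets, of all derivatives) there exists a diffeomorphism $\phi$ of $L$ with $\phi\in\mathcal U$ such that, for every $j\in J$, the map $f_j$ is transverse to $\phi^{\times s_j}(N_j)$; that is, for every $p\in M_j$ with $x:=f_j(p)\in \phi^{\times s_j}(N_j)$, \[ \operatorname{Im} D_pf_j+T_{x}\bigl(\phi^{\times s_j}(N_j)\bigr)=T_{x}L^{s_j}. \] Here $\phi^{\times s}(p_1,\dots,p_s)=(\phi(p_1),\dots,\phi(p_s))$. -/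

import Mathlib

open Set Topology
open scoped Manifold ContDiff Pointwise

namespace DiffTop

/-- The big diagonal of `L^s`: the tuples having at least two equal entries. -/
def bigDiagonal (L : Type*) (s : ℕ) : Set (Fin s → L) :=
  {p | ∃ j k : Fin s, j ≠ k ∧ p j = p k}

/-- The product map `φ^{×s} : L^s → L^s`. -/
def powMap {L : Type*} (s : ℕ) (φ : L → L) : (Fin s → L) → (Fin s → L) :=
  fun x i => φ (x i)

section Submanifold

variable {E : Type*} [NormedAddCommGroup E] [NormedSpace ℝ E]
  {H : Type*} [TopologicalSpace H] (J : ModelWithCorners ℝ E H)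
  {Q : Type*} [TopologicalSpace Q] [ChartedSpace H Q]

/-- `R` is a smooth (embedded, not necessarily closed) submanifold of the manifold `Q`: for some
dimension `k`, every point of `R` lies in a chart of the smooth structure of `Q` in which `R`
is exactly the preimage of a `k`-dimensional linear subspace. -/
def IsSubmanifold (R : Set Q) : Prop :=
  ∃ k : ℕ, ∀ x ∈ R, ∃ e ∈ IsManifold.maximalAtlas J ∞ Q, x ∈ e.source ∧
    ∃ V : Submodule ℝ E, Module.finrank ℝ V = k ∧
      ∀ y ∈ e.source, (y ∈ R ↔ e.extend J y ∈ V)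

/-- The tangent space `T_x R ⊆ T_x Q` of a submanifold `R` of `Q` at `x`: the set of velocities at
time `0` of smooth curves in `Q` that stay in `R` and pass through `x` at time `0`. The equality in
the tangent bundle says that `γ 0 = x` and `γ' 0 = v`. -/
def tangentVectors (R : Set Q) (x : Q) : Set (TangentSpace J x) :=
  {v | ∃ (γ : ℝ → Q) (ε : ℝ), 0 < ε ∧ ContMDiffOn 𝓘(ℝ, ℝ) J ∞ γ (Ioo (-ε) ε) ∧
    MapsTo γ (Ioo (-ε) ε) R ∧
    (⟨γ 0, mfderiv 𝓘(ℝ, ℝ) J γ 0 (1 : ℝ)⟩ : TangentBundle J Q) = ⟨x, v⟩}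

variable {E' : Type*} [NormedAddCommGroup E'] [NormedSpace ℝ E']
  {H' : Type*} [TopologicalSpace H'] (I : ModelWithCorners ℝ E' H')
  {P : Type*} [TopologicalSpace P] [ChartedSpace H' P]

/-- `f : P → Q` is transverse to the submanifold `R` of `Q`: for every `p` with `f p ∈ R`,
`Im D_p f + T_{f p} R = T_{f p} Q`. -/
def IsTransverse (f : P → Q) (R : Set Q) : Prop :=
  ∀ p : P, f p ∈ R →
    Set.range (mfderiv I J f p) + tangentVectors J R (f p) = Set.univ

end Submanifold

section SmoothTopology

variable {E : Type*} [NormedAddCommGroup E] [NormedSpace ℝ E]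
  {F : Type*} [NormedAddCommGroup F] [NormedSpace ℝ F]
  (P : Type*) [TopologicalSpace P] [ChartedSpace E P]
  (Q : Type*) [TopologicalSpace Q] [ChartedSpace F Q]

variable {P Q} in
/-- Basic set of the weak topology: the smooth maps `g` such that `g(K)` lies in the domain of
the chart `e'` and, in the charts `e` and `e'`, all derivatives of `g` of order at most `r` are
`ε`-close to those of `f` at the points of `K`. -/
def smoothBasicSet (f : C^∞⟮𝓘(ℝ, E), P; 𝓘(ℝ, F), Q⟯)
    (e : OpenPartialHomeomorph P E) (e' : OpenPartialHomeomorph Q F)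
    (K : Set P) (r : ℕ) (ε : ℝ) : Set C^∞⟮𝓘(ℝ, E), P; 𝓘(ℝ, F), Q⟯ :=
  {g | MapsTo g K e'.source ∧ ∀ x ∈ K, ∀ k ≤ r,
    ‖iteratedFDeriv ℝ k (e' ∘ f ∘ e.symm) (e x) -
      iteratedFDeriv ℝ k (e' ∘ g ∘ e.symm) (e x)‖ < ε}

/-- The (weak) `C^∞`-topology on the set of smooth maps between two manifolds without boundary. -/
@[reducible] def smoothTopology : TopologicalSpace C^∞⟮𝓘(ℝ, E), P; 𝓘(ℝ, F), Q⟯ :=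
  TopologicalSpace.generateFrom
    {W | ∃ (f : C^∞⟮𝓘(ℝ, E), P; 𝓘(ℝ, F), Q⟯)
      (e : OpenPartialHomeomorph P E) (e' : OpenPartialHomeomorph Q F)
      (K : Set P) (r : ℕ) (ε : ℝ),
      e ∈ IsManifold.maximalAtlas 𝓘(ℝ, E) ∞ P ∧ e' ∈ IsManifold.maximalAtlas 𝓘(ℝ, F) ∞ Q ∧
      IsCompact K ∧ K ⊆ e.source ∧ MapsTo f K e'.source ∧ 0 < ε ∧
      W = smoothBasicSet f e e' K r ε}

end SmoothTopology

end DiffTop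

/-! The proof is parametric transversality over an infinite-dimensional space of parameters. On the
compact manifold `L` there is a smooth family of diffeomorphisms `φ b`, with `b` near `0` in a
Banach space and `φ 0 = id`, whose derivative in `b` realises arbitrary velocities at any finite set
of distinct points (`exists_isDiffFamily_univ`). Moving `s` points independently takes at least `s *
dim L` parameters and the `s j` may be unbounded, so no finite-dimensional family suffices in
general. Points of `N j` have distinct entries, hence `powMap (s j) (φ b) y` is submersive in `b`
for `y ∈ N j`. The equation `f j p = powMap (s j) (φ b) y` is therefore regular in all its
variables, and its regularity in `(p, y)` for a fixed `b` is the desired transversality.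

For finitely many parameters, Sard's theorem (`measure_image_not_surjective_fderiv`), applied to the
projection of the solution set to the parameters, shows that almost every parameter is regular
(`exists_nhds_measure_nonregular_null`). Over a compact set of pairs `(p, y)`, finitely many
directions of `b` already give submersivity, so Sard on finite-dimensional affine slices yields
density of the good parameters, while compactness yields openness (`exists_isOpen_dense_regular`).

Countably many such pieces cover all pairs. Baire's theorem then provides good parameters
arbitrarily close to `0`, and for small `b` the map `φ b` lies in `𝒰`, its derivatives depending
continuously on `b` (`IsDiffFamily.eventually_mem`). -/

open MeasureTheory Filter

namespace DiffTop

/-! ### Smooth inverse and implicit function theorems -/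

section InverseFunction

variable {E F : Type} [NormedAddCommGroup E] [NormedSpace ℝ E]
  [NormedAddCommGroup F] [NormedSpace ℝ F]

/-- A smooth map with invertible derivative at `x` restricts to a smooth local diffeomorphism. -/
theorem exists_openPartialHomeomorph_of_fderiv [CompleteSpace E] {U : Set E} (hU : IsOpen U)
    {f : E → F} (hf : ContDiffOn ℝ ∞ f U) {x : E} (hx : x ∈ U) (f' : E ≃L[ℝ] F)
    (hf' : fderiv ℝ f x = f') :
    ∃ h : OpenPartialHomeomorph E F, x ∈ h.source ∧ h.source ⊆ U ∧ (∀ y, h y = f y) ∧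
      ContDiffOn ℝ ∞ h.symm h.target := by
  have hfa : ∀ y ∈ U, ContDiffAt ℝ ∞ f y := fun y hy => hf.contDiffAt (hU.mem_nhds hy)
  have hd : HasFDerivAt f (f' : E →L[ℝ] F) x := by
    rw [← hf']
    exact ((hfa x hx).differentiableAt (by simp)).hasFDerivAt
  set h₀ := (hfa x hx).toOpenPartialHomeomorph f hd (by simp)
  have hcoe : ∀ y, h₀ y = f y := fun y => rfl
  have hxs : x ∈ h₀.source := (hfa x hx).mem_toOpenPartialHomeomorph_source hd (by simp)
  set R : Set (E →L[ℝ] F) := range ((↑) : (E ≃L[ℝ] F) → E →L[ℝ] F)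
  -- Restricting to the open set where the derivative is invertible makes the inverse smooth on the
  -- whole target, not only at `f x`.
  have hW : IsOpen (U ∩ fderiv ℝ f ⁻¹' R) :=
    (hf.continuousOn_fderiv_of_isOpen hU (by simp)).isOpen_inter_preimage hU
      ContinuousLinearEquiv.isOpen
  refine ⟨h₀.restrOpen _ hW, ⟨hxs, hx, ⟨f', hf'.symm⟩⟩, fun y hy => hy.2.1, hcoe, ?_⟩
  intro y hy
  have hys : (h₀.restrOpen _ hW).symm y ∈ (h₀.restrOpen _ hW).source :=
    (h₀.restrOpen _ hW).map_target hy
  obtain ⟨g', hg'⟩ := hys.2.2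
  refine ((h₀.restrOpen _ hW).contDiffAt_symm (f₀' := g') hy ?_ ?_).contDiffWithinAt
  · rw [hg']
    exact ((hfa _ hys.2.1).differentiableAt (by simp)).hasFDerivAt
  · exact hfa _ hys.2.1

/-- Local coordinates in which a submersion is the first projection. -/
theorem exists_implicit_coordinates [FiniteDimensional ℝ E] [FiniteDimensional ℝ F]
    {U : Set E} (hU : IsOpen U) {f : E → F} (hf : ContDiffOn ℝ ∞ f U) {x : E} (hx : x ∈ U)
    (hs : Function.Surjective (fderiv ℝ f x)) :
    ∃ h : OpenPartialHomeomorph E (F × (fderiv ℝ f x).ker), x ∈ h.source ∧ h.source ⊆ U ∧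
      (∀ y, (h y).1 = f y) ∧ ContDiffOn ℝ ∞ h h.source ∧ ContDiffOn ℝ ∞ h.symm h.target := by
  have : CompleteSpace E := FiniteDimensional.complete ℝ E
  have : CompleteSpace F := FiniteDimensional.complete ℝ F
  set A := fderiv ℝ f x
  -- `P` projects onto `ker A`, so that `y ↦ (f y, P y)` has bijective derivative at `x`.
  obtain ⟨P, hP⟩ := A.ker_closedComplemented_of_finiteDimensional_range
  have hf' : HasFDerivAt f A x :=
    ((hf.contDiffAt (hU.mem_nhds hx)).differentiableAt (by simp)).hasFDerivAt
  have hbij : Function.Bijective (A.prod P) := by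
    constructor
    · rw [injective_iff_map_eq_zero]
      intro v hv
      have h1 : A v = 0 := congrArg Prod.fst hv
      have h2 : P v = 0 := congrArg Prod.snd hv
      have h3 := hP ⟨v, h1⟩
      rw [h2] at h3
      exact (congrArg Subtype.val h3).symm
    · rintro ⟨a, b⟩
      obtain ⟨v, rfl⟩ := hs a
      refine ⟨v - P v + b, ?_⟩
      have h1 : A (P v : E) = 0 := (P v).2
      have h2 : A (b : E) = 0 := b.2
      simp [h1, h2, hP]
  set e := ContinuousLinearEquiv.ofBijective (A.prod P) (LinearMap.ker_eq_bot.2 hbij.1)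
    (LinearMap.range_eq_top.2 hbij.2)
  have he : (e : E →L[ℝ] _) = A.prod P := ContinuousLinearEquiv.coe_ofBijective _ _ _
  have hH : ContDiffOn ℝ ∞ (fun y => (f y, P y)) U := hf.prodMk P.contDiff.contDiffOn
  have hd : fderiv ℝ (fun y => (f y, P y)) x = e := by
    rw [he]
    exact (hf'.prodMk P.hasFDerivAt).fderiv
  obtain ⟨h, h1, h2, h3, h4⟩ := exists_openPartialHomeomorph_of_fderiv hU hH hx e hd
  refine ⟨h, h1, h2, fun y => by rw [h3], ?_, h4⟩
  exact (hH.mono h2).congr fun y _ => h3 y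

end InverseFunction

/-- If every point of `s` has a neighbourhood in `s` with null image, then `s` has null image. -/
theorem measure_image_null_of_locally_null {X Y : Type*} [TopologicalSpace X]
    [SecondCountableTopology X] [MeasurableSpace Y] (μ : Measure Y) (f : X → Y) (s : Set X)
    (h : ∀ x ∈ s, ∃ t ∈ 𝓝[s] x, μ (f '' t) = 0) : μ (f '' s) = 0 := by
  choose! t ht h0 using h
  obtain ⟨c, hcs, hc, hsc⟩ := TopologicalSpace.countable_cover_nhdsWithin ht
  refine measure_mono_null (image_mono hsc) ?_
  rw [image_iUnion₂, measure_biUnion_null_iff hc]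
  exact fun x hx => h0 x (hcs hx)

/-! ### Sard's theorem for real-valued functions -/

section Scalar

variable {E : Type} [NormedAddCommGroup E] [NormedSpace ℝ E]

/-- A uniform Taylor estimate at the points where the derivatives of orders `1, …, N` vanish. -/
theorem exists_norm_sub_le_pow (N : ℕ) : ∀ {G : Type} [NormedAddCommGroup G] [NormedSpace ℝ G]
    {U : Set E} (_ : IsOpen U) {g : E → G} (_ : ContDiffOn ℝ ∞ g U) {x₀ : E} (_ : x₀ ∈ U),
    ∃ C : ℝ, 0 ≤ C ∧ ∃ r > 0, ∀ x ∈ Metric.ball x₀ r, ∀ y ∈ Metric.ball x₀ r,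
      (∀ i, 1 ≤ i → i ≤ N → iteratedFDeriv ℝ i g x = 0) → ‖g y - g x‖ ≤ C * ‖y - x‖ ^ (N + 1) := by
  induction N with
  | zero =>
    intro G _ _ U hU g hg x₀ hx₀
    have hc : ContinuousAt (fderiv ℝ g) x₀ :=
      (hg.continuousOn_fderiv_of_isOpen hU (by simp)).continuousAt (hU.mem_nhds hx₀)
    have h1 : ∀ᶠ y in 𝓝 x₀, ‖fderiv ℝ g y‖ < ‖fderiv ℝ g x₀‖ + 1 :=
      hc.norm.eventually_lt_const (lt_add_one _)
    obtain ⟨r, hr, hball⟩ := Metric.eventually_nhds_iff_ball.1 (h1.and (hU.mem_nhds hx₀))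
    refine ⟨‖fderiv ℝ g x₀‖ + 1, by positivity, r, hr, fun x hx y hy _ => ?_⟩
    rw [zero_add, pow_one]
    refine Convex.norm_image_sub_le_of_norm_fderiv_le (𝕜 := ℝ) (s := Metric.ball x₀ r)
      (fun z hz => ?_) (fun z hz => (hball z hz).1.le) (convex_ball _ _) hx hy
    exact (hg.contDiffAt (hU.mem_nhds (hball z hz).2)).differentiableAt (by simp)
  | succ N ih =>
    intro G _ _ U hU g hg x₀ hx₀
    have hg' : ContDiffOn ℝ ∞ (fderiv ℝ g) U := hg.fderiv_of_isOpen hU (by simp)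
    -- The induction passes to `fderiv ℝ g`, which is why the codomain varies. The mean value
    -- inequality on a segment then gains one power.
    obtain ⟨C, hC, r, hr, hCr⟩ := ih hU hg' hx₀
    obtain ⟨r', hr', hball⟩ := Metric.mem_nhds_iff.1 (hU.mem_nhds hx₀)
    refine ⟨C, hC, min r r', lt_min hr hr', fun x hx y hy hvan => ?_⟩
    have hsub : Metric.ball x₀ (min r r') ⊆ Metric.ball x₀ r :=
      Metric.ball_subset_ball (min_le_left _ _)
    have hsub' : Metric.ball x₀ (min r r') ⊆ U :=
      (Metric.ball_subset_ball (min_le_right _ _)).trans hball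
    have hvan' : ∀ i, 1 ≤ i → i ≤ N → iteratedFDeriv ℝ i (fderiv ℝ g) x = 0 := by
      intro i h1 h2
      have := hvan (i + 1) (by omega) (by omega)
      rw [iteratedFDeriv_succ_eq_comp_right] at this
      rw [Function.comp_apply] at this
      exact (continuousMultilinearCurryRightEquiv' ℝ i E G).symm.map_eq_zero_iff.1 this
    have hx0 : fderiv ℝ g x = 0 := by
      have := hvan 1 le_rfl (by omega)
      rw [← norm_eq_zero, ← norm_iteratedFDeriv_one, this, norm_zero]
    have hseg : segment ℝ x y ⊆ Metric.ball x₀ (min r r') :=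
      (convex_ball _ _).segment_subset hx hy
    have hb : ∀ z ∈ segment ℝ x y, ‖fderiv ℝ g z‖ ≤ C * ‖y - x‖ ^ (N + 1) := by
      intro z hz
      have h1 := hCr x (hsub hx) z (hsub (hseg hz)) hvan'
      rw [hx0, sub_zero] at h1
      refine h1.trans ?_
      have : ‖z - x‖ ≤ ‖y - x‖ := by
        obtain ⟨t, ht, rfl⟩ := (segment_eq_image' ℝ x y) ▸ hz
        rw [add_sub_cancel_left, norm_smul, Real.norm_of_nonneg ht.1]
        exact mul_le_of_le_one_left (norm_nonneg _) ht.2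
      gcongr
    have := Convex.norm_image_sub_le_of_norm_fderiv_le (𝕜 := ℝ) (s := segment ℝ x y)
      (fun z hz => (hg.contDiffAt (hU.mem_nhds (hsub' (hseg hz)))).differentiableAt (by simp))
      hb (convex_segment _ _) (left_mem_segment ℝ x y) (right_mem_segment ℝ x y)
    rwa [pow_succ, ← mul_assoc]

/-- The points where the derivatives of orders `1, …, N` vanish. -/
def flatSet (U : Set E) (g : E → ℝ) (N : ℕ) : Set E :=
  {x ∈ U | ∀ i, 1 ≤ i → i ≤ N → iteratedFDeriv ℝ i g x = 0}

/-- On the flat set `g` is locally Hölder of exponent `N + 1`, so the image has Hausdorff dimension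
at most `N / (N + 1) < 1`. -/
theorem volume_image_flatSet [FiniteDimensional ℝ E] {U : Set E} (hU : IsOpen U) {g : E → ℝ}
    (hg : ContDiffOn ℝ ∞ g U) {N : ℕ} (hN : Module.finrank ℝ E ≤ N) :
    volume (g '' flatSet U g N) = 0 := by
  have : ProperSpace E := FiniteDimensional.proper_real E
  have h : dimH (g '' flatSet U g N) ≤ dimH (flatSet U g N) / ((N + 1 : ℕ) : NNReal) := by
    refine dimH_image_le_of_locally_holder_on (by positivity) fun x hx => ?_
    obtain ⟨C, hC, r, hr, h⟩ := exists_norm_sub_le_pow N hU hg hx.1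
    lift C to NNReal using hC
    refine ⟨C, Metric.ball x r ∩ flatSet U g N,
      inter_mem (mem_nhdsWithin_of_mem_nhds (Metric.ball_mem_nhds x hr)) self_mem_nhdsWithin, ?_⟩
    intro a ha b hb
    have h1 := h b hb.1 a ha.1 hb.2.2
    rw [edist_dist, edist_dist, dist_eq_norm, dist_eq_norm]
    have h2 : ENNReal.ofReal (C * ‖a - b‖ ^ (N + 1)) =
        (C : ENNReal) * (ENNReal.ofReal ‖a - b‖) ^ (((N + 1 : ℕ) : NNReal) : ℝ) := by
      rw [ENNReal.ofReal_mul (NNReal.coe_nonneg C), NNReal.coe_natCast, ENNReal.rpow_natCast,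
        ENNReal.ofReal_pow (norm_nonneg _)]
      congr 1
      exact ENNReal.ofReal_coe_nnreal
    rw [← h2]
    exact ENNReal.ofReal_le_ofReal h1
  have h2 : dimH (flatSet U g N) ≤ (N : ENNReal) := by
    refine (dimH_mono (subset_univ _)).trans ?_
    rw [Real.dimH_univ_eq_finrank]
    exact_mod_cast hN
  have h3 : dimH (g '' flatSet U g N) < ((1 : NNReal) : ENNReal) := by
    refine h.trans_lt ((ENNReal.div_le_div_right h2 _).trans_lt ?_)
    rw [ENNReal.div_lt_iff (by simp) (by simp)]
    simp only [ENNReal.coe_one, one_mul]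
    norm_cast
    omega
  have h4 := hausdorffMeasure_of_dimH_lt h3
  rwa [NNReal.coe_one, hausdorffMeasure_real] at h4

/-- **Sard's theorem** for smooth real-valued functions. -/
theorem volume_image_critical_eq_zero (m : ℕ) : ∀ {E : Type} [NormedAddCommGroup E]
    [NormedSpace ℝ E] [FiniteDimensional ℝ E] (_ : Module.finrank ℝ E = m)
    {U : Set E} (_ : IsOpen U) {g : E → ℝ} (_ : ContDiffOn ℝ ∞ g U),
    volume (g '' {x ∈ U | fderiv ℝ g x = 0}) = 0 := by
  induction m with
  | zero =>
    intro E _ _ _ hE U hU g hg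
    have : Subsingleton E := Module.finrank_zero_iff.1 hE
    exact ((subsingleton_of_subsingleton (s := {x ∈ U | fderiv ℝ g x = 0})).image g).measure_zero _
  | succ m ih =>
    intro E _ _ _ hE U hU g hg
    have : ProperSpace E := FiniteDimensional.proper_real E
    -- Near a point of this stratum some partial derivative `w` of order `k` has nonzero
    -- differential. As `k ≥ 1`, `w` vanishes on the stratum, which thus lies in an `m`-dimensional
    -- hypersurface, parametrised by `ζ` below. Its points are critical for `g ∘ ζ` too, so the
    -- induction hypothesis applies.
    have hstep : ∀ k, 1 ≤ k → volume (g '' (flatSet U g k \ flatSet U g (k + 1))) = 0 := by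
      intro k hk
      refine measure_image_null_of_locally_null _ _ _ fun x hx => ?_
      obtain ⟨⟨hxU, hxk⟩, hx'⟩ := hx
      have hne : iteratedFDeriv ℝ (k + 1) g x ≠ 0 := by
        intro h0
        refine hx' ⟨hxU, fun i h1 h2 => ?_⟩
        rcases Nat.lt_or_ge k i with h | h
        · rwa [show i = k + 1 by omega]
        · exact hxk i h1 h
      obtain ⟨v, hv⟩ : ∃ v, iteratedFDeriv ℝ (k + 1) g x v ≠ 0 := by
        by_contra! h
        exact hne (ContinuousMultilinearMap.ext h)
      set w : E → ℝ := fun y => iteratedFDeriv ℝ k g y (Fin.tail v) with hw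
      have hgk : ContDiffOn ℝ ∞ (iteratedFDeriv ℝ k g) U := by
        intro y hy
        exact ((hg.contDiffAt (hU.mem_nhds hy)).iteratedFDeriv_right
          (i := k) (m := ∞) (by exact_mod_cast le_top)).contDiffWithinAt
      set ev := ContinuousMultilinearMap.apply ℝ (fun _ : Fin k => E) ℝ (Fin.tail v)
      have hwU : ContDiffOn ℝ ∞ w U := ev.contDiff.comp_contDiffOn hgk
      have hdw : fderiv ℝ w x (v 0) ≠ 0 := by
        have hd : HasFDerivAt (iteratedFDeriv ℝ k g) (fderiv ℝ (iteratedFDeriv ℝ k g) x) x :=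
          ((hgk.contDiffAt (hU.mem_nhds hxU)).differentiableAt (by simp)).hasFDerivAt
        have : fderiv ℝ w x = ev.comp (fderiv ℝ (iteratedFDeriv ℝ k g) x) :=
          (ev.hasFDerivAt.comp x hd).fderiv
        rw [this]
        rwa [iteratedFDeriv_succ_apply_left] at hv
      have hsurj : Function.Surjective (fderiv ℝ w x) := by
        intro c
        exact ⟨(c / fderiv ℝ w x (v 0)) • v 0, by simp [hdw]⟩
      obtain ⟨h, hxh, hhU, hfst, hh, hhs⟩ := exists_implicit_coordinates hU hwU hxU hsurj
      have hK : Module.finrank ℝ (fderiv ℝ w x).ker = m := by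
        have h1 := LinearMap.finrank_range_add_finrank_ker (fderiv ℝ w x : E →ₗ[ℝ] ℝ)
        have h2 : Module.finrank ℝ (LinearMap.range (fderiv ℝ w x : E →ₗ[ℝ] ℝ)) = 1 := by
          rw [LinearMap.range_eq_top.2 hsurj, finrank_top, Module.finrank_self]
        rw [h2, hE] at h1
        have h3 : Module.finrank ℝ (fderiv ℝ w x).ker =
          Module.finrank ℝ (LinearMap.ker (fderiv ℝ w x : E →ₗ[ℝ] ℝ)) := rfl
        omega
      set V : Set (fderiv ℝ w x).ker := (fun κ : (fderiv ℝ w x).ker => ((0 : ℝ), κ)) ⁻¹' h.target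
      have hV : IsOpen V := h.open_target.preimage (by fun_prop)
      set ζ : (fderiv ℝ w x).ker → E := fun κ => h.symm (0, κ)
      have hζ : ContDiffOn ℝ ∞ ζ V := hhs.comp (contDiff_const.prodMk contDiff_id).contDiffOn (fun κ hκ => hκ)
      have hζU : MapsTo ζ V U := fun κ hκ => hhU (h.map_target hκ)
      have hnull := ih hK hV (hg.comp hζ hζU)
      refine ⟨h.source ∩ (flatSet U g k \ flatSet U g (k + 1)), inter_mem
        (mem_nhdsWithin_of_mem_nhds (h.open_source.mem_nhds hxh)) self_mem_nhdsWithin, ?_⟩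
      refine measure_mono_null ?_ hnull
      rintro _ ⟨y, ⟨hys, ⟨hyU, hyk⟩, -⟩, rfl⟩
      have hy0 : h y = (0, (h y).2) := by
        refine Prod.ext ?_ rfl
        rw [hfst]
        simp [hw, hyk k hk le_rfl]
      have hζy : ζ (h y).2 = y := by
        simp only [ζ, ← hy0]
        exact h.left_inv hys
      have hyV : (h y).2 ∈ V := by
        simp only [V, mem_preimage, ← hy0]
        exact h.map_source hys
      refine ⟨(h y).2, ⟨hyV, ?_⟩, by simp [hζy]⟩
      have hg0 : fderiv ℝ g (ζ (h y).2) = 0 := by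
        rw [hζy, ← norm_eq_zero, ← norm_iteratedFDeriv_one, hyk 1 le_rfl hk, norm_zero]
      rw [fderiv_comp _ ((hg.contDiffAt (hU.mem_nhds (hζU hyV))).differentiableAt (by simp))
        ((hζ.contDiffAt (hV.mem_nhds hyV)).differentiableAt (by simp)), hg0,
        ContinuousLinearMap.zero_comp]
    have hsub : {x ∈ U | fderiv ℝ g x = 0} ⊆
        flatSet U g (m + 1) ∪ ⋃ k : ℕ, (flatSet U g (k + 1) \ flatSet U g (k + 2)) := by
      rintro x ⟨hxU, hx⟩
      by_contra hcon
      simp only [mem_union, mem_iUnion, Set.mem_sdiff, not_or, not_exists, not_and, not_not] at hcon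
      refine hcon.1 ?_
      have : ∀ k, x ∈ flatSet U g (k + 1) := by
        intro k
        induction k with
        | zero =>
          refine ⟨hxU, fun i h1 h2 => ?_⟩
          rw [show i = 1 by omega, ← norm_eq_zero, norm_iteratedFDeriv_one, hx, norm_zero]
        | succ k ihk => exact hcon.2 k ihk
      exact this m
    refine measure_mono_null (image_mono hsub) ?_
    rw [image_union, image_iUnion]
    refine measure_union_null (volume_image_flatSet hU hg hE.le) (measure_iUnion_null fun k => ?_)
    exact hstep (k + 1) (by omega)

end Scalar

/-- Surjectivity onto a finite-dimensional space is an open condition. -/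
theorem isOpen_setOf_surjective {E F : Type*} [NormedAddCommGroup E] [NormedSpace ℝ E]
    [NormedAddCommGroup F] [NormedSpace ℝ F] [FiniteDimensional ℝ F] :
    IsOpen {A : E →L[ℝ] F | Function.Surjective A} := by
  have : CompleteSpace F := FiniteDimensional.complete ℝ F
  refine isOpen_iff_mem_nhds.2 fun A hA => ?_
  -- With `S` a right inverse of `A`, nearby `A'` have `A' ∘ S` invertible, since invertibility is
  -- open.
  obtain ⟨S, hS⟩ := (A : E →ₗ[ℝ] F).exists_rightInverse_of_surjective (LinearMap.range_eq_top.2 hA)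
  set S' : F →L[ℝ] E := LinearMap.toContinuousLinearMap S
  have hAS : A.comp S' = (ContinuousLinearEquiv.refl ℝ F : F →L[ℝ] F) :=
    ContinuousLinearMap.ext fun y => DFunLike.congr_fun hS y
  have hc : Continuous fun A' : E →L[ℝ] F => A'.comp S' := by fun_prop
  have hmem : A.comp S' ∈ range ((↑) : (F ≃L[ℝ] F) → F →L[ℝ] F) := ⟨_, hAS.symm⟩
  filter_upwards [(ContinuousLinearEquiv.isOpen.preimage hc).mem_nhds hmem] with A' hA'
  obtain ⟨e, he⟩ := hA'
  intro y
  obtain ⟨z, rfl⟩ := e.surjective y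
  exact ⟨S' z, (DFunLike.congr_fun he z).symm⟩

/-! ### Sard's theorem for vector-valued maps -/

section Sard

/-- Preimages of null sets under surjective linear maps are null. -/
theorem measure_preimage_null_of_surjective {E F : Type*} [NormedAddCommGroup E]
    [NormedSpace ℝ E] [FiniteDimensional ℝ E] [MeasurableSpace E] [BorelSpace E]
    [NormedAddCommGroup F] [NormedSpace ℝ F] [MeasurableSpace F] [BorelSpace F]
    (L : E →L[ℝ] F) (hL : Function.Surjective L) (μ : Measure E) (ν : Measure F)
    [μ.IsAddHaarMeasure] [ν.IsAddHaarMeasure] {s : Set F} (hs : ν s = 0) : μ (L ⁻¹' s) = 0 := by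
  have : ProperSpace E := FiniteDimensional.proper_real E
  obtain ⟨c, -, hc⟩ := LinearMap.exists_map_addHaar_eq_smul_addHaar (L : E →ₗ[ℝ] F) μ ν hL
  refine Measure.preimage_null_of_map_null L.continuous.measurable.aemeasurable ?_
  change Measure.map (L : E →ₗ[ℝ] F) μ s = 0
  rw [hc, Measure.smul_apply, hs, smul_zero]

variable {E F F₁ F₂ K : Type} [NormedAddCommGroup E] [NormedSpace ℝ E] [FiniteDimensional ℝ E]
  [NormedAddCommGroup F] [NormedSpace ℝ F] [FiniteDimensional ℝ F]
  [MeasurableSpace F] [BorelSpace F]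
  [NormedAddCommGroup F₁] [NormedSpace ℝ F₁] [FiniteDimensional ℝ F₁]
  [MeasurableSpace F₁] [BorelSpace F₁]
  [NormedAddCommGroup F₂] [NormedSpace ℝ F₂] [FiniteDimensional ℝ F₂]
  [MeasurableSpace F₂] [BorelSpace F₂]
  [NormedAddCommGroup K] [NormedSpace ℝ K] [FiniteDimensional ℝ K]

/-- Where the whole derivative vanishes, one nonzero functional `l` suffices: the image lies in the
preimage under `l` of the null set of critical values of `l ∘ g`. -/
theorem measure_image_fderiv_eq_zero [Nontrivial F₂] (ν : Measure F₂) [ν.IsAddHaarMeasure]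
    {U : Set E} (hU : IsOpen U) {g : E → F₂} (hg : ContDiffOn ℝ ∞ g U) :
    ν (g '' {x ∈ U | fderiv ℝ g x = 0}) = 0 := by
  obtain ⟨v, hv⟩ := exists_ne (0 : F₂)
  obtain ⟨l, -, hl⟩ := exists_dual_vector ℝ v (norm_ne_zero_iff.2 hv)
  have hl0 : l v ≠ 0 := by
    rw [hl]
    simpa using hv
  have hsurj : Function.Surjective l := fun c => ⟨(c / l v) • v, by simp [hl0]⟩
  have h1 := volume_image_critical_eq_zero _ (rfl : Module.finrank ℝ E = _) hU
    (l.contDiff.comp_contDiffOn hg)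
  refine measure_mono_null ?_ (measure_preimage_null_of_surjective l hsurj ν volume h1)
  rintro _ ⟨x, ⟨hxU, hx⟩, rfl⟩
  refine ⟨x, ⟨hxU, ?_⟩, rfl⟩
  rw [fderiv_comp _ l.differentiableAt ((hg.contDiffAt (hU.mem_nhds hxU)).differentiableAt
    (by simp)), hx, ContinuousLinearMap.comp_zero]

theorem fderiv_slice {P X G : Type*} [NormedAddCommGroup P] [NormedSpace ℝ P]
    [NormedAddCommGroup X] [NormedSpace ℝ X] [NormedAddCommGroup G] [NormedSpace ℝ G]
    {g : P × X → G} {z : P × X} (hg : DifferentiableAt ℝ g z) :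
    HasFDerivAt (fun x => g (z.1, x)) ((fderiv ℝ g z).comp (ContinuousLinearMap.inr ℝ P X)) z.2 :=
  HasFDerivAt.comp (g := g) z.2 hg.hasFDerivAt (hasFDerivAt_prodMk_right z.1 z.2)

/-- Fubini: the slice of the image over `t` consists of values of `g (t, ·)` at points where its
derivative is zero. Compactness of `C` makes the image compact, hence measurable. -/
theorem measure_image_graph_critical [Nontrivial F₂] (μ : Measure F₁) (ν : Measure F₂)
    [μ.IsAddHaarMeasure] [ν.IsAddHaarMeasure] {V : Set (F₁ × K)} (hV : IsOpen V)
    {g : F₁ × K → F₂} (hg : ContDiffOn ℝ ∞ g V) {C : Set (F₁ × K)} (hC : IsCompact C)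
    (hCV : C ⊆ V) :
    (μ.prod ν) ((fun z : F₁ × K => (z.1, g z)) ''
      {z ∈ C | (fderiv ℝ g z).comp (ContinuousLinearMap.inr ℝ F₁ K) = 0}) = 0 := by
  have : ProperSpace F₁ := FiniteDimensional.proper_real F₁
  have : ProperSpace F₂ := FiniteDimensional.proper_real F₂
  set A : Set (F₁ × K) := {z ∈ C | (fderiv ℝ g z).comp (ContinuousLinearMap.inr ℝ F₁ K) = 0}
  have hcont : ContinuousOn (fun z => (fderiv ℝ g z).comp (ContinuousLinearMap.inr ℝ F₁ K)) C :=
    ((hg.continuousOn_fderiv_of_isOpen hV (by simp)).mono hCV).clm_comp continuousOn_const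
  have hA : IsCompact A := by
    obtain ⟨Z, hZ, hZC⟩ := (continuousOn_iff_isClosed.1 hcont) {0} isClosed_singleton
    have : A = Z ∩ C := by
      rw [← hZC]
      ext z
      simp [A, and_comm]
    rw [this, inter_comm]
    exact hC.inter_right hZ
  have himg : IsCompact ((fun z : F₁ × K => (z.1, g z)) '' A) := by
    refine hA.image_of_continuousOn ?_
    exact continuousOn_fst.prodMk (hg.continuousOn.mono fun z hz => hCV hz.1)
  rw [Measure.measure_prod_null himg.measurableSet]
  refine Eventually.of_forall fun t => ?_
  have hVt : IsOpen ((fun k : K => (t, k)) ⁻¹' V) := hV.preimage (by fun_prop)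
  have hgt : ContDiffOn ℝ ∞ (fun k => g (t, k)) ((fun k : K => (t, k)) ⁻¹' V) :=
    hg.comp (contDiff_const.prodMk contDiff_id).contDiffOn fun k hk => hk
  refine measure_mono_null ?_ (measure_image_fderiv_eq_zero ν hVt hgt)
  rintro y ⟨⟨t', k⟩, hz, heq⟩
  obtain ⟨rfl, rfl⟩ := Prod.mk.inj heq
  refine ⟨k, ⟨hCV hz.1, ?_⟩, rfl⟩
  have hd := (hg.contDiffAt (hV.mem_nhds (hCV hz.1))).differentiableAt (by simp)
  exact (fderiv_slice hd).fderiv.trans hz.2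

/-- With the first component of `L ∘ f` as a coordinate, `L ∘ f` becomes `(t, κ) ↦ (t, g (t, κ))`.
By `hS`, directions along the fibre are killed by the full derivative at points of `S`, so
`measure_image_graph_critical` applies. -/
theorem exists_nhdsWithin_measure_image_null [Nontrivial F₂] (μ : Measure F) [μ.IsAddHaarMeasure]
    (L : F ≃L[ℝ] F₁ × F₂) {U : Set E} (hU : IsOpen U) {f : E → F} (hf : ContDiffOn ℝ ∞ f U)
    {x₀ : E} (hx₀ : x₀ ∈ U) (hsurj : Function.Surjective fun v => (L (fderiv ℝ f x₀ v)).1)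
    (S : Set E) (hS : ∀ x ∈ S, ∀ v, (L (fderiv ℝ f x v)).1 = 0 → fderiv ℝ f x v = 0) :
    ∃ t ∈ 𝓝[S] x₀, μ (f '' t) = 0 := by
  set f₁ : E → F₁ := fun x => (L (f x)).1
  have hf₁ : ContDiffOn ℝ ∞ f₁ U := (contDiff_fst.comp L.contDiff).comp_contDiffOn hf
  have hdf : ∀ x ∈ U, HasFDerivAt f (fderiv ℝ f x) x := fun x hx =>
    ((hf.contDiffAt (hU.mem_nhds hx)).differentiableAt (by simp)).hasFDerivAt
  have hf₁' : ∀ x ∈ U, HasFDerivAt f₁ ((ContinuousLinearMap.fst ℝ F₁ F₂).comp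
      ((L : F →L[ℝ] F₁ × F₂).comp (fderiv ℝ f x))) x := fun x hx =>
    (ContinuousLinearMap.fst ℝ F₁ F₂).hasFDerivAt.comp x (L.hasFDerivAt.comp x (hdf x hx))
  have hsurj₁ : Function.Surjective (fderiv ℝ f₁ x₀) := by
    rw [(hf₁' x₀ hx₀).fderiv]
    exact hsurj
  obtain ⟨h, hxh, hhU, hfst, hh, hhs⟩ := exists_implicit_coordinates hU hf₁ hx₀ hsurj₁
  set g : F₁ × (fderiv ℝ f₁ x₀).ker → F₂ := fun z => (L (f (h.symm z))).2 with hg_def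
  have hfh : ContDiffOn ℝ ∞ (fun z => L (f (h.symm z))) h.target :=
    L.contDiff.comp_contDiffOn (hf.comp hhs fun z hz => hhU (h.map_target hz))
  have hg : ContDiffOn ℝ ∞ g h.target := contDiff_snd.comp_contDiffOn hfh
  have : ProperSpace (F₁ × (fderiv ℝ f₁ x₀).ker) := FiniteDimensional.proper_real _
  obtain ⟨C, hC, hCn, hCV⟩ := exists_compact_subset h.open_target (h.map_source hxh)
  have hnull := measure_image_graph_critical (Measure.addHaar : Measure F₁)
    (Measure.addHaar : Measure F₂) h.open_target hg hC hCV
  have hnull' := measure_preimage_null_of_surjective (L : F →L[ℝ] F₁ × F₂) L.surjective μ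
    ((Measure.addHaar : Measure F₁).prod (Measure.addHaar : Measure F₂)) hnull
  refine ⟨(h.source ∩ h ⁻¹' interior C) ∩ S, inter_mem (mem_nhdsWithin_of_mem_nhds
    ((h.isOpen_inter_preimage isOpen_interior).mem_nhds ⟨hxh, hCn⟩)) self_mem_nhdsWithin, ?_⟩
  refine measure_mono_null ?_ hnull'
  rintro _ ⟨x, ⟨⟨hxs, hxC⟩, hxS⟩, rfl⟩
  have hxC' : h x ∈ C := interior_subset hxC
  refine ⟨h x, ⟨hxC', ?_⟩, ?_⟩
  · have hxt : h x ∈ h.target := h.map_source hxs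
    have hsd : HasFDerivAt h.symm (fderiv ℝ h.symm (h x)) (h x) :=
      ((hhs.contDiffAt (h.open_target.mem_nhds hxt)).differentiableAt (by simp)).hasFDerivAt
    have hdx : HasFDerivAt f (fderiv ℝ f x) (h.symm (h x)) := by
      rw [h.left_inv hxs]
      exact hdf x (hhU hxs)
    have hgd : HasFDerivAt (fun z => L (f (h.symm z)))
        ((L : F →L[ℝ] F₁ × F₂).comp ((fderiv ℝ f x).comp (fderiv ℝ h.symm (h x)))) (h x) :=
      L.hasFDerivAt.comp (h x) (hdx.comp (h x) hsd)
    have hfst' : (fun z => (L (f (h.symm z))).1) =ᶠ[𝓝 (h x)] Prod.fst := by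
      filter_upwards [h.open_target.mem_nhds hxt] with z hz
      have := hfst (h.symm z)
      rw [h.right_inv hz] at this
      exact this.symm
    have h1 : (ContinuousLinearMap.fst ℝ F₁ F₂).comp ((L : F →L[ℝ] F₁ × F₂).comp
        ((fderiv ℝ f x).comp (fderiv ℝ h.symm (h x)))) = ContinuousLinearMap.fst ℝ _ _ :=
      ((ContinuousLinearMap.fst ℝ F₁ F₂).hasFDerivAt.comp (h x) hgd).unique
        (hasFDerivAt_fst.congr_of_eventuallyEq hfst')
    have h2 : fderiv ℝ g (h x) = (ContinuousLinearMap.snd ℝ F₁ F₂).comp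
        ((L : F →L[ℝ] F₁ × F₂).comp ((fderiv ℝ f x).comp (fderiv ℝ h.symm (h x)))) :=
      ((ContinuousLinearMap.snd ℝ F₁ F₂).hasFDerivAt.comp (h x) hgd).fderiv
    rw [h2]
    refine ContinuousLinearMap.ext fun κ => ?_
    have h3 := DFunLike.congr_fun h1 ((0 : F₁), κ)
    have h4 := hS x hxS (fderiv ℝ h.symm (h x) ((0 : F₁), κ)) h3
    simp [h4]
  · refine Prod.ext ?_ ?_
    · exact hfst x
    · simp only [hg_def]
      rw [h.left_inv hxs]
      rfl

/-- **Sard's theorem** for smooth maps between finite-dimensional spaces. -/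
theorem measure_image_not_surjective_fderiv (μ : Measure F) [μ.IsAddHaarMeasure] {U : Set E}
    (hU : IsOpen U) {f : E → F} (hf : ContDiffOn ℝ ∞ f U) :
    μ (f '' {x ∈ U | ¬ Function.Surjective (fderiv ℝ f x)}) = 0 := by
  have : ProperSpace E := FiniteDimensional.proper_real E
  -- The critical set is split by the rank of the derivative, a countable partition.
  have hsub : {x ∈ U | ¬ Function.Surjective (fderiv ℝ f x)} ⊆ ⋃ r : ℕ,
      {x ∈ U | ¬ Function.Surjective (fderiv ℝ f x) ∧
        Module.finrank ℝ (fderiv ℝ f x).range = r} :=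
    fun x hx => mem_iUnion.2 ⟨_, hx.1, hx.2, rfl⟩
  refine measure_mono_null (image_mono hsub) ?_
  rw [image_iUnion]
  refine measure_iUnion_null fun r => measure_image_null_of_locally_null _ _ _ ?_
  rintro x₀ ⟨hx₀, hns, hr⟩
  set R := (fderiv ℝ f x₀).range
  obtain ⟨R', hRR'⟩ := R.exists_isCompl
  have hne : Nontrivial R' := by
    rw [Submodule.nontrivial_iff_ne_bot]
    rintro rfl
    exact hns (LinearMap.range_eq_top.1 (eq_top_of_isCompl_bot hRR'))
  set L : F ≃L[ℝ] R × R' :=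
    (Submodule.prodEquivOfIsCompl R R' hRR').symm.toContinuousLinearEquiv
  have hL : ∀ y : R, (L y).1 = y := fun y => by
    simp [L]
  set Φ : E → E →L[ℝ] R := fun x =>
    (ContinuousLinearMap.fst ℝ R R').comp ((L : F →L[ℝ] R × R').comp (fderiv ℝ f x))
  have hΦ : ContinuousOn Φ U :=
    continuousOn_const.clm_comp (continuousOn_const.clm_comp
      (hf.continuousOn_fderiv_of_isOpen hU (by simp)))
  have hΦx : Function.Surjective (Φ x₀) := by
    rintro ⟨y, v, rfl⟩
    exact ⟨v, hL ⟨_, v, rfl⟩⟩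
  have hO := hΦ.isOpen_inter_preimage hU isOpen_setOf_surjective
  obtain ⟨t, ht, hnull⟩ := exists_nhdsWithin_measure_image_null μ L hU hf hx₀ hΦx
    ({x | x ∈ U ∧ ¬ Function.Surjective (fderiv ℝ f x) ∧
        Module.finrank ℝ (fderiv ℝ f x).range = r} ∩
      (U ∩ Φ ⁻¹' {A | Function.Surjective A})) (by
    rintro x ⟨⟨-, -, hrx⟩, -, hx⟩ v hv
    -- The range at `x` has the same dimension as `R` and projects onto it, hence injectively. A
    -- vector with vanishing `R`-component of its image is thus in the kernel.
    set ψ : (fderiv ℝ f x).range →ₗ[ℝ] R :=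
      (LinearMap.fst ℝ R R' ∘ₗ (L : F →ₗ[ℝ] R × R')) ∘ₗ (fderiv ℝ f x).range.subtype
    have hψ : Function.Surjective ψ := by
      intro y
      obtain ⟨v, hv⟩ := hx y
      exact ⟨⟨_, v, rfl⟩, hv⟩
    have hinj : Function.Injective ψ :=
      (LinearMap.injective_iff_surjective_of_finrank_eq_finrank (hrx.trans hr.symm)).2 hψ
    have : (⟨fderiv ℝ f x v, v, rfl⟩ : (fderiv ℝ f x).range) = 0 := by
      apply hinj
      rw [map_zero]
      exact hv
    exact congrArg Subtype.val this)
  refine ⟨t, ?_, hnull⟩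
  rwa [nhdsWithin_inter_of_mem' (mem_nhdsWithin_of_mem_nhds (hO.mem_nhds ⟨hx₀, hΦx⟩))] at ht

end Sard

/-! ### Parametric transversality in normed spaces -/

section Parametric

variable {T X F : Type} [NormedAddCommGroup T] [NormedSpace ℝ T]
  [NormedAddCommGroup X] [NormedSpace ℝ X] [FiniteDimensional ℝ X]
  [NormedAddCommGroup F] [NormedSpace ℝ F] [FiniteDimensional ℝ F]

/-- Local **parametric transversality**: if `G` is submersive in the parameter at a point, then for
almost every parameter `0` is a regular value of the slice of `G` near that point. -/
theorem exists_nhds_measure_nonregular_null [FiniteDimensional ℝ T] [MeasurableSpace T]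
    [BorelSpace T] (μ : Measure T) [μ.IsAddHaarMeasure]
    {Ω : Set (T × X)} (hΩ : IsOpen Ω) {G : T × X → F} (hG : ContDiffOn ℝ ∞ G Ω) {z₀ : T × X}
    (hz₀ : z₀ ∈ Ω)
    (hsurj : Function.Surjective ((fderiv ℝ G z₀).comp (ContinuousLinearMap.inl ℝ T X))) :
    ∃ W ∈ 𝓝 z₀, μ {t | ∃ x, (t, x) ∈ W ∧ G (t, x) = 0 ∧
      ¬ Function.Surjective ((fderiv ℝ G (t, x)).comp (ContinuousLinearMap.inr ℝ T X))} = 0 := by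
  have hs : Function.Surjective (fderiv ℝ G z₀) := fun y => by
    obtain ⟨v, hv⟩ := hsurj y
    exact ⟨_, hv⟩
  obtain ⟨h, hzh, hhΩ, hfst, hh, hhs⟩ := exists_implicit_coordinates hΩ hG hz₀ hs
  set V : Set (fderiv ℝ G z₀).ker := (fun κ => ((0 : F), κ)) ⁻¹' h.target
  have hV : IsOpen V := h.open_target.preimage (by fun_prop)
  set ζ : (fderiv ℝ G z₀).ker → T × X := fun κ => h.symm (0, κ)
  have hζ : ContDiffOn ℝ ∞ ζ V :=
    hhs.comp (contDiff_const.prodMk contDiff_id).contDiffOn (fun κ hκ => hκ)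
  -- `ζ` parametrises the solution set of `G = 0`. Sard is applied to its projection to the
  -- parameters, whose critical values contain all bad `t`.
  have hnull := measure_image_not_surjective_fderiv μ hV (contDiff_fst.comp_contDiffOn hζ)
  have hcont : ContinuousOn (fun z => (fderiv ℝ G z).comp (ContinuousLinearMap.inl ℝ T X)) Ω :=
    (hG.continuousOn_fderiv_of_isOpen hΩ (by simp)).clm_comp continuousOn_const
  refine ⟨h.source ∩ (Ω ∩ (fun z => (fderiv ℝ G z).comp (ContinuousLinearMap.inl ℝ T X)) ⁻¹'
    {A | Function.Surjective A}), inter_mem (h.open_source.mem_nhds hzh)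
    ((hcont.isOpen_inter_preimage hΩ isOpen_setOf_surjective).mem_nhds ⟨hz₀, hsurj⟩),
    measure_mono_null ?_ hnull⟩
  rintro t ⟨x, ⟨hzs, hzΩ, hzsurj⟩, hz0, hns⟩
  set z : T × X := (t, x)
  have hy0 : h z = (0, (h z).2) := Prod.ext (by rw [hfst, hz0]) rfl
  have hζz : ζ (h z).2 = z := by
    simp only [ζ, ← hy0]
    exact h.left_inv hzs
  have hzV : (h z).2 ∈ V := by
    simp only [V, mem_preimage, ← hy0]
    exact h.map_source hzs
  refine ⟨(h z).2, ⟨hzV, fun hcon => hns fun w => ?_⟩, by simp [hζz, z]⟩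
  have hζd : HasFDerivAt ζ (fderiv ℝ ζ (h z).2) (h z).2 :=
    ((hζ.contDiffAt (hV.mem_nhds hzV)).differentiableAt (by simp)).hasFDerivAt
  have hGd : HasFDerivAt G (fderiv ℝ G z) (ζ (h z).2) := by
    rw [hζz]
    exact ((hG.contDiffAt (hΩ.mem_nhds hzΩ)).differentiableAt (by simp)).hasFDerivAt
  have hzero : (fderiv ℝ G z).comp (fderiv ℝ ζ (h z).2) = 0 := by
    refine (hGd.comp (h z).2 hζd).unique ((hasFDerivAt_const (0 : F) _).congr_of_eventuallyEq ?_)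
    filter_upwards [hV.mem_nhds hzV] with κ hκ
    have := hfst (ζ κ)
    rw [h.right_inv hκ] at this
    exact this.symm
  -- Write `w` as the parameter derivative along `τ` and lift `τ` to a tangent vector `(τ, ξ)` of
  -- the solution set. Since `dG (τ, ξ) = 0`, the slice derivative along `-ξ` is `w`.
  obtain ⟨τ, hτ⟩ := hzsurj w
  obtain ⟨κ, hκ⟩ := hcon τ
  have hfd : fderiv ℝ (Prod.fst ∘ ζ) (h z).2 =
      (ContinuousLinearMap.fst ℝ T X).comp (fderiv ℝ ζ (h z).2) :=
    ((ContinuousLinearMap.fst ℝ T X).hasFDerivAt.comp _ hζd).fderiv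
  have hκ1 : (fderiv ℝ ζ (h z).2 κ).1 = τ := by
    rw [← hκ]
    exact (DFunLike.congr_fun hfd κ).symm
  have hκ2 : fderiv ℝ G z (fderiv ℝ ζ (h z).2 κ) = 0 := DFunLike.congr_fun hzero κ
  refine ⟨-(fderiv ℝ ζ (h z).2 κ).2, ?_⟩
  have hsplit : fderiv ℝ ζ (h z).2 κ = (τ, 0) + (0, (fderiv ℝ ζ (h z).2 κ).2) := by
    rw [← hκ1]
    simp
  rw [hsplit, map_add] at hκ2
  have hτ' : fderiv ℝ G z (τ, 0) = w := hτ
  rw [hτ'] at hκ2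
  have : fderiv ℝ G z (0, -(fderiv ℝ ζ (h z).2 κ).2) = w := by
    rw [show ((0 : T), -(fderiv ℝ ζ (h z).2 κ).2) = -(0, (fderiv ℝ ζ (h z).2 κ).2) by simp,
      map_neg]
    exact (eq_neg_of_add_eq_zero_left hκ2).symm
  exact this

variable {B : Type} [NormedAddCommGroup B] [NormedSpace ℝ B]

theorem exists_finiteDimensional_surjective (A : B →L[ℝ] F) (hA : Function.Surjective A) :
    ∃ T : Submodule ℝ B, FiniteDimensional ℝ T ∧ Function.Surjective (A.comp T.subtypeL) := by
  obtain ⟨S, hS⟩ := (A : B →ₗ[ℝ] F).exists_rightInverse_of_surjective (LinearMap.range_eq_top.2 hA)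
  exact ⟨S.range, inferInstance, fun y => ⟨⟨S y, y, rfl⟩, DFunLike.congr_fun hS y⟩⟩

/-- A parametrised family `G` of equations, submersive in the parameter, has for an open and dense
set of parameters only regular solutions in a given compact set. The solution set is `Z`, and `G`
needs to be defined near it only. -/
theorem exists_isOpen_dense_regular {O : Set B} (hO : IsOpen O) {C : Set X} (hC : IsCompact C)
    {Ω : Set (B × X)} (hΩ : IsOpen Ω) {G : B × X → F} (hG : ContDiffOn ℝ ∞ G Ω)
    {Z : Set (B × X)} (hZ : ∀ b ∈ O, ∀ x ∈ C, (b, x) ∉ Z → ∀ᶠ z in 𝓝 (b, x), z ∉ Z)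
    (hZΩ : ∀ b ∈ O, ∀ x ∈ C, (b, x) ∈ Z → (b, x) ∈ Ω) (hZG : ∀ z ∈ Ω, z ∈ Z → G z = 0)
    (hsurj : ∀ b ∈ O, ∀ x ∈ C, (b, x) ∈ Z →
      Function.Surjective ((fderiv ℝ G (b, x)).comp (ContinuousLinearMap.inl ℝ B X))) :
    ∃ A ⊆ O, IsOpen A ∧ O ⊆ closure A ∧ ∀ b ∈ A, ∀ x ∈ C, (b, x) ∈ Z →
      Function.Surjective ((fderiv ℝ G (b, x)).comp (ContinuousLinearMap.inr ℝ B X)) := by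
  have hG' : ContinuousOn (fderiv ℝ G) Ω := hG.continuousOn_fderiv_of_isOpen hΩ (by simp)
  refine ⟨{b | b ∈ O ∧ ∀ x ∈ C, (b, x) ∈ Z →
      Function.Surjective ((fderiv ℝ G (b, x)).comp (ContinuousLinearMap.inr ℝ B X))},
    fun b hb => hb.1, ?_, ?_, fun b hb => hb.2⟩
  -- Openness: both regularity at a solution and not being a solution persist nearby, and `C` is
  -- compact.
  · refine isOpen_iff_mem_nhds.2 ?_
    rintro b ⟨hb, hreg⟩
    refine inter_mem (hO.mem_nhds hb) (hC.eventually_forall_of_forall_eventually fun x hx => ?_)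
    by_cases hz : (b, x) ∈ Z
    · have hcont : ContinuousOn
          (fun z => (fderiv ℝ G z).comp (ContinuousLinearMap.inr ℝ B X)) Ω :=
        hG'.clm_comp continuousOn_const
      filter_upwards [(hcont.isOpen_inter_preimage hΩ isOpen_setOf_surjective).mem_nhds
        ⟨hZΩ b hb x hx hz, hreg x hx hz⟩] with z hz _ using hz.2
    · filter_upwards [hZ b hb x hx hz] with z hz h using absurd h hz
  intro b hb
  -- Density: by compactness one finite-dimensional `T` gives submersivity at `b` over all of `C`,
  -- so Sard can be used on the slice `b + T`.
  obtain ⟨T, hTfin, hT⟩ : ∃ T : Submodule ℝ B, FiniteDimensional ℝ T ∧ ∀ x ∈ C, (b, x) ∈ Z →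
      Function.Surjective (((fderiv ℝ G (b, x)).comp (ContinuousLinearMap.inl ℝ B X)).comp
        T.subtypeL) := by
    refine hC.induction_on (p := fun S => ∃ T : Submodule ℝ B, FiniteDimensional ℝ T ∧
      ∀ x ∈ S, (b, x) ∈ Z → Function.Surjective (((fderiv ℝ G (b, x)).comp
        (ContinuousLinearMap.inl ℝ B X)).comp T.subtypeL)) ?_ ?_ ?_ ?_
    · exact ⟨⊥, inferInstance, fun x hx => hx.elim⟩
    · rintro S S' hSS' ⟨T, h1, h2⟩
      exact ⟨T, h1, fun x hx => h2 x (hSS' hx)⟩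
    · rintro S S' ⟨T, h1, h2⟩ ⟨T', h1', h2'⟩
      refine ⟨T ⊔ T', inferInstance, ?_⟩
      rintro x (hx | hx) hz y
      · obtain ⟨v, hv⟩ := h2 x hx hz y
        exact ⟨⟨v, Submodule.mem_sup_left v.2⟩, hv⟩
      · obtain ⟨v, hv⟩ := h2' x hx hz y
        exact ⟨⟨v, Submodule.mem_sup_right v.2⟩, hv⟩
    · intro x hx
      by_cases hz : (b, x) ∈ Z
      · obtain ⟨T, h1, h2⟩ := exists_finiteDimensional_surjective _ (hsurj b hb x hx hz)
        have hcont : ContinuousOn (fun z => ((fderiv ℝ G z).comp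
            (ContinuousLinearMap.inl ℝ B X)).comp T.subtypeL) Ω :=
          (hG'.clm_comp continuousOn_const).clm_comp continuousOn_const
        have hev := (hcont.isOpen_inter_preimage hΩ isOpen_setOf_surjective).mem_nhds
          ⟨hZΩ b hb x hx hz, h2⟩
        have hx' : Continuous fun x : X => (b, x) := by fun_prop
        exact ⟨_, mem_nhdsWithin_of_mem_nhds (hx'.continuousAt.preimage_mem_nhds hev), T, h1,
          fun x' hx' _ => hx'.2⟩
      · have hx' : Continuous fun x : X => (b, x) := by fun_prop
        exact ⟨_, mem_nhdsWithin_of_mem_nhds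
          (hx'.continuousAt.preimage_mem_nhds (hZ b hb x hx hz)), ⊥, inferInstance,
          fun x' hx' h => absurd h hx'⟩
  let _ : MeasurableSpace T := borel T
  have : BorelSpace T := ⟨rfl⟩
  have : ProperSpace T := FiniteDimensional.proper_real T
  set μ : Measure T := Measure.addHaar
  have hι : ContDiff ℝ ∞ (fun z : T × X => (b + (z.1 : B), z.2)) :=
    (contDiff_const.add (T.subtypeL.contDiff.comp contDiff_fst)).prodMk contDiff_snd
  have hι' : ∀ z : T × X, HasFDerivAt (fun z : T × X => (b + (z.1 : B), z.2))
      (T.subtypeL.prodMap (ContinuousLinearMap.id ℝ X)) z := fun z =>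
    ((T.subtypeL.hasFDerivAt.comp z hasFDerivAt_fst).const_add b).prodMk hasFDerivAt_snd
  have hΩ' := hΩ.preimage hι.continuous
  have hG₂ : ContDiffOn ℝ ∞ (fun z : T × X => G (b + (z.1 : B), z.2)) _ :=
    hG.comp hι.contDiffOn (fun z hz => hz)
  have hd : ∀ z : T × X, (b + (z.1 : B), z.2) ∈ Ω →
      fderiv ℝ (fun z : T × X => G (b + (z.1 : B), z.2)) z =
        (fderiv ℝ G (b + (z.1 : B), z.2)).comp
          (T.subtypeL.prodMap (ContinuousLinearMap.id ℝ X)) := fun z hz =>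
    (HasFDerivAt.comp (g := G) z ((hG.contDiffAt (hΩ.mem_nhds hz)).differentiableAt
      (by simp)).hasFDerivAt (hι' z)).fderiv
  obtain ⟨V, hV, hVnull⟩ : ∃ V ∈ 𝓝 (0 : T), μ {t | t ∈ V ∧ ∃ x ∈ C, (b + (t : B), x) ∈ Z ∧
      ¬ Function.Surjective ((fderiv ℝ G (b + (t : B), x)).comp
        (ContinuousLinearMap.inr ℝ B X))} = 0 := by
    refine hC.induction_on (p := fun S => ∃ V ∈ 𝓝 (0 : T), μ {t | t ∈ V ∧ ∃ x ∈ S,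
      (b + (t : B), x) ∈ Z ∧ ¬ Function.Surjective ((fderiv ℝ G (b + (t : B), x)).comp
        (ContinuousLinearMap.inr ℝ B X))} = 0) ?_ ?_ ?_ ?_
    · exact ⟨univ, univ_mem, by simp⟩
    · rintro S S' hSS' ⟨V, h1, h2⟩
      refine ⟨V, h1, measure_mono_null ?_ h2⟩
      rintro t ⟨ht, x, hx, h⟩
      exact ⟨ht, x, hSS' hx, h⟩
    · rintro S S' ⟨V, h1, h2⟩ ⟨V', h1', h2'⟩
      refine ⟨V ∩ V', inter_mem h1 h1', measure_mono_null ?_ (measure_union_null h2 h2')⟩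
      rintro t ⟨ht, x, hx | hx, h⟩
      · exact Or.inl ⟨ht.1, x, hx, h⟩
      · exact Or.inr ⟨ht.2, x, hx, h⟩
    · intro x hx
      have h0 : (b + ((0 : T) : B), x) = (b, x) := by simp
      by_cases hz : (b, x) ∈ Z
      · have hzΩ : (b + ((0 : T) : B), x) ∈ Ω := by
          rw [h0]
          exact hZΩ b hb x hx hz
        have hs : Function.Surjective ((fderiv ℝ (fun z : T × X => G (b + (z.1 : B), z.2))
            (0, x)).comp (ContinuousLinearMap.inl ℝ T X)) := by
          rw [hd _ hzΩ]
          intro y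
          obtain ⟨v, hv⟩ := hT x hx hz y
          refine ⟨v, ?_⟩
          rw [← hv]
          simp
        obtain ⟨W, hW, hnull⟩ := exists_nhds_measure_nonregular_null μ hΩ' hG₂
          (z₀ := ((0 : T), x)) hzΩ hs
        obtain ⟨V, hV, V', hV', hsub⟩ := mem_nhds_prod_iff.1
          (inter_mem hW (hΩ'.mem_nhds (x := ((0 : T), x)) hzΩ))
        refine ⟨V', mem_nhdsWithin_of_mem_nhds hV', V, hV, measure_mono_null ?_ hnull⟩
        rintro t ⟨ht, x', hx', hz', hns⟩
        obtain ⟨hW', hΩt⟩ := hsub (mk_mem_prod ht hx')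
        refine ⟨x', hW', hZG _ hΩt hz', ?_⟩
        rw [hd _ hΩt]
        intro hcon
        refine hns fun y => ?_
        obtain ⟨v, hv⟩ := hcon y
        refine ⟨v, ?_⟩
        rw [← hv]
        simp
      · have hev := hZ b hb x hx hz
        rw [← h0] at hev
        obtain ⟨V, hV, V', hV', hsub⟩ := mem_nhds_prod_iff.1
          (hι.continuous.continuousAt.preimage_mem_nhds (x := ((0 : T), x)) hev)
        refine ⟨V', mem_nhdsWithin_of_mem_nhds hV', V, hV, ?_⟩
        convert measure_empty (μ := μ)
        refine eq_empty_of_forall_notMem ?_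
        rintro t ⟨ht, x', hx', hz', -⟩
        exact hsub (mk_mem_prod ht hx') hz'
  rw [mem_closure_iff_nhds]
  intro N hN
  have hadd : Tendsto (fun t : T => b + (t : B)) (𝓝 0) (𝓝 b) := by
    have : Continuous fun t : T => b + (t : B) := by fun_prop
    simpa using this.tendsto 0
  -- A neighbourhood of `0` in `T` has positive Haar measure, so the null set of bad parameters
  -- cannot fill it.
  have hmem : V ∩ (fun t : T => b + (t : B)) ⁻¹' (N ∩ O) ∈ 𝓝 (0 : T) :=
    inter_mem hV (hadd (inter_mem hN (hO.mem_nhds hb)))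
  have hpos := Measure.measure_pos_of_mem_nhds μ hmem
  obtain ⟨t, ⟨htV, htN, htO⟩, htg⟩ := nonempty_of_measure_ne_zero
    ((measure_sdiff_null hVnull).trans_ne hpos.ne')
  refine ⟨b + (t : B), htN, htO, fun x hx hz => ?_⟩
  by_contra hns
  exact htg ⟨htV, x, hx, hz, hns⟩

end Parametric

/-! ### Interpolating families of vector fields on a vector space -/

section Interpolation

variable {E : Type} [NormedAddCommGroup E] [NormedSpace ℝ E] [FiniteDimensional ℝ E]

/-- A sequence of bump functions supported in `D` that separates the points of `D` from the finite
sets. -/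
theorem exists_separating_bumps {D : Set E} (hD : IsOpen D) :
    ∃ g : ℕ → E → ℝ, (∀ a, ContDiff ℝ ∞ (g a)) ∧ (∀ a, HasCompactSupport (g a)) ∧
      (∀ a, ∀ x ∉ D, g a x = 0) ∧
      ∀ x ∈ D, ∀ F : Set E, F.Finite → x ∉ F → ∃ a, g a x ≠ 0 ∧ ∀ y ∈ F, g a y = 0 := by
  classical
  have : ProperSpace E := FiniteDimensional.proper_real E
  set q := TopologicalSpace.denseSeq E
  have hpos : ∀ k : ℕ, (0 : ℝ) < 1 / (2 * (k + 1)) := fun k => by positivity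
  have hlt : ∀ k : ℕ, (1 : ℝ) / (2 * (k + 1)) < 1 / (k + 1) := fun k => by
    apply one_div_lt_one_div_of_lt <;> nlinarith [(Nat.cast_nonneg k : (0 : ℝ) ≤ k)]
  set β : ∀ i k : ℕ, ContDiffBump (q i) := fun i k => ⟨1 / (2 * (k + 1)), 1 / (k + 1), hpos k, hlt k⟩
  -- Bumps whose supporting ball leaves `D` are replaced by `0`, which keeps all pairs `(i, k)` as
  -- indices.
  set γ : ℕ → ℕ → E → ℝ := fun i k =>
    if Metric.ball (q i) (1 / (k + 1)) ⊆ D then (β i k : E → ℝ) else 0 with hγ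
  refine ⟨fun a => γ a.unpair.1 a.unpair.2, fun a => ?_, fun a => ?_, fun a x hx => ?_, ?_⟩
  · simp only [hγ]
    split_ifs
    · exact (β _ _).contDiff
    · exact contDiff_const
  · simp only [hγ]
    split_ifs
    · exact (β _ _).hasCompactSupport
    · exact HasCompactSupport.zero
  · simp only [hγ]
    split_ifs with h
    · rw [← Function.notMem_support, (β _ _).support_eq]
      exact fun hx' => hx (h hx')
    · rfl
  · intro x hx F hF hxF
    obtain ⟨r, hr, hball⟩ := Metric.mem_nhds_iff.1
      ((hD.inter hF.isClosed.isOpen_compl).mem_nhds ⟨hx, hxF⟩)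
    obtain ⟨k, hk⟩ := exists_nat_one_div_lt (half_pos hr)
    obtain ⟨i, hi⟩ := (TopologicalSpace.denseRange_denseSeq E).exists_dist_lt x
      (show (0 : ℝ) < 1 / (k + 1) by positivity)
    have hsub : Metric.ball (q i) (1 / (k + 1)) ⊆ D ∩ Fᶜ := by
      refine Subset.trans (fun y hy => ?_) hball
      rw [Metric.mem_ball] at hy ⊢
      have := dist_triangle y (q i) x
      rw [dist_comm (q i) x] at this
      linarith
    refine ⟨Nat.pair i k, ?_, fun y hy => ?_⟩
    all_goals
      simp only [hγ, Nat.unpair_pair]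
      rw [if_pos (hsub.trans inter_subset_left)]
    · rw [← Function.mem_support, (β _ _).support_eq]
      exact hi
    · rw [← Function.notMem_support, (β _ _).support_eq]
      exact fun hy' => (hsub hy').2 hy

open BoundedContinuousFunction in
/-- A smooth family of endomorphism-valued evaluations supported in `D` that interpolates arbitrary
values at finitely many points. -/
theorem exists_interpolating {D : Set E} (hD : IsOpen D) (hDb : Bornology.IsBounded D) :
    ∃ w : E → ((ℕ →ᵇ E) →L[ℝ] E), ContDiff ℝ ∞ w ∧ (∀ x ∉ D, w x = 0) ∧
      (∃ M, ∀ x, ‖fderiv ℝ w x‖ ≤ M) ∧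
      ∀ x ∈ D, ∀ F : Set E, F.Finite → x ∉ F → ∀ ξ, ∃ b, w x b = ξ ∧ ∀ y ∈ F, w y b = 0 := by
  classical
  have : ProperSpace E := FiniteDimensional.proper_real E
  obtain ⟨g, hg, hgc, hgD, hsep⟩ := exists_separating_bumps hD
  have hbd : ∀ a k : ℕ, ∃ S : ℝ, 0 ≤ S ∧ ∀ x, ‖iteratedFDeriv ℝ k (g a) x‖ ≤ S := fun a k => by
    obtain ⟨S, hS⟩ := ((hg a).continuous_iteratedFDeriv (m := k)
      (by exact_mod_cast le_top)).bounded_above_of_compact_support ((hgc a).iteratedFDeriv k)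
    exact ⟨S, (norm_nonneg _).trans (hS 0), hS⟩
  choose S hS0 hS using hbd
  -- `Q a` dominates all derivatives of `g a` up to order `a`. With weights `c a = 2⁻ᵃ / Q a`, the
  -- order-`k` derivatives of the `a`-th term are at most `2⁻ᵃ` once `a ≥ k`, enough for `w x b = ∑
  -- c a * g a x • b a` to be smooth in `x`.
  set Q : ℕ → ℝ := fun a => 1 + ∑ k ∈ Finset.range (a + 1), S a k
  have hQ : ∀ a, 0 < Q a := fun a => by
    have := Finset.sum_nonneg fun k (_ : k ∈ Finset.range (a + 1)) => hS0 a k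
    simp only [Q]
    linarith
  set c : ℕ → ℝ := fun a => (1 / 2) ^ a / Q a
  have hc : ∀ a, 0 < c a := fun a => div_pos (by positivity) (hQ a)
  set ev : ℕ → (ℕ →ᵇ E) →L[ℝ] E := fun a => evalCLM ℝ a
  have hev : ∀ a, ‖ev a‖ ≤ 1 := fun a =>
    ContinuousLinearMap.opNorm_le_bound _ zero_le_one fun b => by
      rw [one_mul]
      exact b.norm_coe_le_norm a
  set l : ℕ → ℝ →L[ℝ] ((ℕ →ᵇ E) →L[ℝ] E) := fun a =>
    ContinuousLinearMap.toSpanSingleton ℝ (c a • ev a)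
  have hl : ∀ a, ‖l a‖ ≤ c a := fun a => by
    simp only [l, ContinuousLinearMap.norm_toSpanSingleton, norm_smul,
      Real.norm_of_nonneg (hc a).le]
    exact mul_le_of_le_one_right (hc a).le (hev a)
  have hbound : ∀ k a : ℕ, k ≤ a → ∀ x,
      ‖iteratedFDeriv ℝ k (fun x => l a (g a x)) x‖ ≤ (1 / 2) ^ a := by
    intro k a hka x
    have h1 := (l a).norm_iteratedFDeriv_comp_left ((hg a).contDiffAt (x := x))
      (n := k) (by exact_mod_cast le_top)
    refine h1.trans ?_
    have h2 : S a k ≤ Q a := by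
      have := Finset.single_le_sum (f := S a) (fun k _ => hS0 a k)
        (Finset.mem_range.2 (Nat.lt_succ_of_le hka))
      simp only [Q]
      linarith
    calc ‖l a‖ * ‖iteratedFDeriv ℝ k (g a) x‖ ≤ c a * Q a :=
          mul_le_mul (hl a) ((hS a k x).trans h2) (norm_nonneg _) (hc a).le
      _ = (1 / 2) ^ a := div_mul_cancel₀ _ (hQ a).ne'
  have hgeom : Summable fun a : ℕ => ((1 : ℝ) / 2) ^ a := summable_geometric_two
  have hsum : ∀ x, Summable fun a => l a (g a x) := fun x => by
    refine Summable.of_norm_bounded hgeom fun a => ?_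
    have := hbound 0 a (Nat.zero_le _) x
    rwa [norm_iteratedFDeriv_zero] at this
  set w : E → ((ℕ →ᵇ E) →L[ℝ] E) := fun x => ∑' a, l a (g a x)
  have hw : ContDiff ℝ ∞ w := by
    refine contDiff_tsum_of_eventually (N := ⊤) (v := fun _ a => (1 / 2) ^ a)
      (fun a => (l a).contDiff.comp (hg a)) (fun _ _ => hgeom) fun k _ => ?_
    rw [Nat.cofinite_eq_atTop]
    filter_upwards [eventually_ge_atTop k] with a ha using hbound k a ha
  have hwD : ∀ x ∉ D, w x = 0 := fun x hx => by
    simp only [w, hgD _ x hx, map_zero, tsum_zero]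
  have hwb : ∀ x b, w x b = ∑' a, (c a * g a x) • b a := fun x b => by
    have := (ContinuousLinearMap.apply ℝ E b).map_tsum (hsum x)
    refine this.trans (tsum_congr fun a => ?_)
    simp [l, ev, smul_smul, mul_comm]
  have hwc : HasCompactSupport w := by
    refine HasCompactSupport.intro (K := closure D) hDb.isCompact_closure fun x hx => ?_
    exact hwD x fun h => hx (subset_closure h)
  obtain ⟨M, hM⟩ := (hw.continuous_fderiv (by simp)).bounded_above_of_compact_support
    (hwc.fderiv ℝ)
  refine ⟨w, hw, hwD, ⟨M, hM⟩, fun x hx F hF hxF ξ => ?_⟩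
  obtain ⟨a, hax, haF⟩ := hsep x hx F hF hxF
  -- A sequence supported at the single index `a` suffices, because `g a` is nonzero at `x` and
  -- vanishes on `F`.
  have hsingle : ∀ v : E, ∃ b : ℕ →ᵇ E, ∀ i, b i = Pi.single (M := fun _ => E) a v i := fun v =>
    ⟨ofNormedAddCommGroupDiscrete (Pi.single (M := fun _ => E) a v) ‖v‖ fun i => by
      rcases eq_or_ne i a with rfl | h
      · simp
      · simp [h], fun i => rfl⟩
  obtain ⟨b, hb⟩ := hsingle ((c a * g a x)⁻¹ • ξ)
  have hwy : ∀ y, w y b = (c a * g a y) • (c a * g a x)⁻¹ • ξ := fun y => by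
    rw [hwb, tsum_eq_single a]
    · rw [hb, Pi.single_eq_same]
    · intro i hi
      rw [hb, Pi.single_eq_of_ne hi, smul_zero]
  refine ⟨b, ?_, fun y hy => ?_⟩
  · rw [hwy, smul_smul, mul_inv_cancel₀ (mul_ne_zero (hc a).ne' hax), one_smul]
  · rw [hwy, haF y hy, mul_zero, zero_smul]

end Interpolation

/-! ### Transporting maps from a chart to the manifold -/

section Lift

variable {E : Type} [NormedAddCommGroup E] {L : Type*} [TopologicalSpace L]

open Classical in
/-- The self-map of a manifold that is `T` in the chart `e` and the identity elsewhere. -/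
noncomputable def chartLift (e : OpenPartialHomeomorph L E) (T : E → E) (x : L) : L :=
  if x ∈ e.source then e.symm (T (e x)) else x

theorem chartLift_of_mem {e : OpenPartialHomeomorph L E} {T : E → E} {x : L} (hx : x ∈ e.source) :
    chartLift e T x = e.symm (T (e x)) := if_pos hx

theorem chartLift_of_notMem {e : OpenPartialHomeomorph L E} {T : E → E} {x : L}
    (hx : x ∉ e.source) : chartLift e T x = x := if_neg hx

theorem chartLift_comp {e : OpenPartialHomeomorph L E} {T T' : E → E}
    (hT : MapsTo T e.target e.target) (h : ∀ x, T' (T x) = x) (x : L) :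
    chartLift e T' (chartLift e T x) = x := by
  by_cases hx : x ∈ e.source
  · have hy := hT (e.map_source hx)
    rw [chartLift_of_mem hx, chartLift_of_mem (e.map_target hy), e.right_inv hy, h, e.left_inv hx]
  · rw [chartLift_of_notMem hx, chartLift_of_notMem hx]

variable [NormedSpace ℝ E] [ChartedSpace E L] {B : Type} [NormedAddCommGroup B] [NormedSpace ℝ B]

/-- The chart domain and the complement of `e.symm '' K` are open and cover `L`. On the latter the
lift is the identity. Hausdorffness makes the compact set `e.symm '' K` closed. -/
theorem contMDiffOn_chartLift [T2Space L]
    {e : OpenPartialHomeomorph L E} (he : e ∈ IsManifold.maximalAtlas 𝓘(ℝ, E) ∞ L)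
    {K : Set E} (hK : IsCompact K) (hKe : K ⊆ e.target) {O : Set B} (hO : IsOpen O)
    {T : B → E → E} (hT : ContDiffOn ℝ ∞ (fun z : B × E => T z.1 z.2) (O ×ˢ univ))
    (hTK : ∀ b ∈ O, ∀ x ∉ K, T b x = x) (hTe : ∀ b ∈ O, MapsTo (T b) e.target e.target) :
    ContMDiffOn (𝓘(ℝ, B).prod 𝓘(ℝ, E)) 𝓘(ℝ, E) ∞ (fun z : B × L => chartLift e (T z.1) z.2)
      (O ×ˢ univ) := by
  rintro ⟨b, x⟩ ⟨hb, -⟩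
  refine ContMDiffAt.contMDiffWithinAt ?_
  by_cases hx : x ∈ e.source
  · have h1 : ContMDiffAt (𝓘(ℝ, B).prod 𝓘(ℝ, E)) 𝓘(ℝ, E) ∞ (fun z : B × L => e z.2) (b, x) :=
      ((contMDiffOn_of_mem_maximalAtlas he).contMDiffAt (e.open_source.mem_nhds hx)).comp (b, x)
        contMDiffAt_snd
    have h2 : ContMDiffAt (𝓘(ℝ, B).prod 𝓘(ℝ, E)) 𝓘(ℝ, B × E) ∞ (fun z : B × L => (z.1, e z.2))
        (b, x) := by
      rw [modelWithCornersSelf_prod, ← chartedSpaceSelf_prod]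
      exact contMDiffAt_fst.prodMk h1
    have h3 : ContMDiffAt 𝓘(ℝ, B × E) 𝓘(ℝ, E) ∞ (fun z : B × E => T z.1 z.2) (b, e x) :=
      (hT.contDiffAt ((hO.prod isOpen_univ).mem_nhds ⟨hb, mem_univ _⟩)).contMDiffAt
    have h4 : ContMDiffAt 𝓘(ℝ, E) 𝓘(ℝ, E) ∞ e.symm (T b (e x)) :=
      (contMDiffOn_symm_of_mem_maximalAtlas he).contMDiffAt
        (e.open_target.mem_nhds (hTe b hb (e.map_source hx)))
    have h5 := ContMDiffAt.comp (b, x) (g := e.symm) h4 (ContMDiffAt.comp (b, x) h3 h2)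
    refine h5.congr_of_eventuallyEq ?_
    filter_upwards [(e.open_source.preimage continuous_snd).mem_nhds hx] with z hz
    exact chartLift_of_mem hz
  · have hcl : IsClosed (e.symm '' K) :=
      (hK.image_of_continuousOn (e.continuousOn_symm.mono hKe)).isClosed
    have hx' : x ∈ (e.symm '' K)ᶜ := by
      rintro ⟨y, hy, rfl⟩
      exact hx (e.map_target (hKe hy))
    refine contMDiffAt_snd.congr_of_eventuallyEq ?_
    filter_upwards [(hO.prod hcl.isOpen_compl).mem_nhds (mk_mem_prod hb hx')] with z hz
    by_cases hzs : z.2 ∈ e.source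
    · rw [chartLift_of_mem hzs, hTK _ hz.1, e.left_inv hzs]
      exact fun h => hz.2 ⟨_, h, e.left_inv hzs⟩
    · exact chartLift_of_notMem hzs

end Lift

/-! ### Local families of diffeomorphisms -/

section Family

variable (E : Type) [NormedAddCommGroup E] [NormedSpace ℝ E]
  {L : Type*} [TopologicalSpace L] [ChartedSpace E L]
  {B : Type} [NormedAddCommGroup B] [NormedSpace ℝ B]

/-- A smooth family of diffeomorphisms of `L`, parametrised by a neighbourhood `O` of `0`, that is
the identity at `0` and moves the points of `S` independently of any finite set of other points. -/
structure IsDiffFamily (φ : B → L → L) (O : Set B) (S : Set L) : Prop where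
  isOpen : IsOpen O
  zero_mem : (0 : B) ∈ O
  contMDiffOn : ContMDiffOn (𝓘(ℝ, B).prod 𝓘(ℝ, E)) 𝓘(ℝ, E) ∞ (fun z : B × L => φ z.1 z.2)
    (O ×ˢ univ)
  exists_diffeomorph : ∀ b ∈ O, ∃ ψ : L ≃ₘ⟮𝓘(ℝ, E), 𝓘(ℝ, E)⟯ L, ⇑ψ = φ b
  zero_apply : ∀ x, φ 0 x = x
  interpolates : ∀ b ∈ O, ∀ y ∈ S, ∀ F : Set L, F.Finite → y ∉ F →
    ∀ ξ : TangentSpace 𝓘(ℝ, E) (φ b y), ∃ b' : B,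
      mfderiv 𝓘(ℝ, B) 𝓘(ℝ, E) (fun b => φ b y) b b' = ξ ∧
      ∀ y' ∈ F, mfderiv 𝓘(ℝ, B) 𝓘(ℝ, E) (fun b => φ b y') b b' = 0

variable {E}

/-- A linear map within `1 / 2` of the identity is injective, hence invertible in finite dimension,
so the inverse function theorem applies everywhere. -/
theorem contDiff_symm_toHomeomorph_of_norm_fderiv_le [FiniteDimensional ℝ E] (T : E ≃ₜ E)
    (hT : ContDiff ℝ ∞ T)
    (hd : ∀ x, ‖fderiv ℝ T x - ContinuousLinearMap.id ℝ E‖ ≤ 1 / 2) : ContDiff ℝ ∞ T.symm := by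
  have : CompleteSpace E := FiniteDimensional.complete ℝ E
  rw [contDiff_iff_contDiffAt]
  intro y
  set A := fderiv ℝ T (T.symm y)
  have hinj : Function.Injective A := by
    rw [injective_iff_map_eq_zero]
    intro v hv
    have h1 := (A - ContinuousLinearMap.id ℝ E).le_of_opNorm_le (hd (T.symm y)) v
    simp only [sub_apply, hv, ContinuousLinearMap.id_apply, zero_sub,
      norm_neg] at h1
    exact norm_eq_zero.1 (by linarith [norm_nonneg v])
  set e := ContinuousLinearEquiv.ofBijective A (LinearMap.ker_eq_bot.2 hinj)
    (LinearMap.range_eq_top.2 ((LinearMap.injective_iff_surjective (f := (A : E →ₗ[ℝ] E))).1 hinj))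
  have he : (e : E →L[ℝ] E) = A := ContinuousLinearEquiv.coe_ofBijective _ _ _
  refine T.toOpenPartialHomeomorph.contDiffAt_symm (f₀' := e) (mem_univ _) ?_ hT.contDiffAt
  rw [he]
  exact (hT.differentiable (by simp) _).hasFDerivAt

/-- Every point of a manifold has a neighbourhood whose points are moved independently by some
smooth family of diffeomorphisms. -/
theorem exists_isDiffFamily_nhds [FiniteDimensional ℝ E] [IsManifold 𝓘(ℝ, E) ∞ L] [T2Space L]
    (x₀ : L) : ∃ S ∈ 𝓝 x₀, IsOpen S ∧
      ∃ (φ : BoundedContinuousFunction ℕ E → L → L) (O : Set _), IsDiffFamily E φ O S := by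
  have : ProperSpace E := FiniteDimensional.proper_real E
  have : CompleteSpace E := FiniteDimensional.complete ℝ E
  set e : OpenPartialHomeomorph L E := chartAt E x₀
  have he : e ∈ IsManifold.maximalAtlas 𝓘(ℝ, E) ∞ L := IsManifold.chart_mem_maximalAtlas x₀
  obtain ⟨R, hR, hRe⟩ := Metric.nhds_basis_closedBall.mem_iff.1
    (e.open_target.mem_nhds (mem_chart_target E x₀))
  set D := Metric.ball (e x₀) R
  have hDe : D ⊆ e.target := Metric.ball_subset_closedBall.trans hRe
  obtain ⟨w, hw, hwD, ⟨M, hM⟩, hint⟩ := exists_interpolating (D := D) Metric.isOpen_ball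
    Metric.isBounded_ball
  have hM0 : 0 ≤ M := le_trans (norm_nonneg (fderiv ℝ w 0)) (hM 0)
  -- Chosen so that `M * δ ≤ 1 / 2`, making `x ↦ w x b` a `1 / 2`-contraction for `b ∈ O` and `T b`
  -- a homeomorphism. The `+ 1` covers `M = 0`.
  set δ : ℝ := 1 / (2 * (M + 1))
  have hδ : 0 < δ := by positivity
  set O : Set (BoundedContinuousFunction ℕ E) := Metric.ball 0 δ
  set T : BoundedContinuousFunction ℕ E → E → E := fun b x => x + w x b
  have hTs : ContDiff ℝ ∞ (fun z : BoundedContinuousFunction ℕ E × E => T z.1 z.2) :=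
    contDiff_snd.add ((hw.comp contDiff_snd).clm_apply contDiff_fst)
  have hTb : ∀ b, ContDiff ℝ ∞ (T b) := fun b => hTs.comp (contDiff_const.prodMk contDiff_id)
  have hTd : ∀ b x, HasFDerivAt (T b) (ContinuousLinearMap.id ℝ E + (fderiv ℝ w x).flip b) x :=
    fun b x => by
      have h1 : HasFDerivAt (fun x => w x b) ((fderiv ℝ w x).flip b) x :=
        ((ContinuousLinearMap.apply ℝ E b).hasFDerivAt.comp x
          (hw.differentiable (by simp) x).hasFDerivAt)
      exact (hasFDerivAt_id x).add h1
  have hsmall : ∀ b ∈ O, ∀ x, ‖(fderiv ℝ w x).flip b‖ ≤ 1 / 2 := by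
    intro b hb x
    refine ContinuousLinearMap.opNorm_le_bound _ (by norm_num) fun v => ?_
    have hb' : ‖b‖ ≤ δ := (mem_ball_zero_iff.1 hb).le
    calc ‖fderiv ℝ w x v b‖ ≤ ‖fderiv ℝ w x‖ * ‖v‖ * ‖b‖ := (fderiv ℝ w x).le_opNorm₂ v b
      _ ≤ M * ‖v‖ * δ := by gcongr; exact hM x
      _ = (M * δ) * ‖v‖ := by ring
      _ ≤ 1 / 2 * ‖v‖ := by
        gcongr
        simp only [δ]
        rw [mul_one_div, div_le_div_iff₀ (by positivity) (by norm_num)]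
        linarith
  have hTD : ∀ b x, x ∉ D → T b x = x := fun b x hx => by simp [T, hwD x hx]
  have happ : ∀ b ∈ O, ApproximatesLinearOn (T b)
      ((ContinuousLinearEquiv.refl ℝ E : E ≃L[ℝ] E) : E →L[ℝ] E) univ (1 / 2 : NNReal) := by
    intro b hb x _ y _
    have h1 : ∀ z, HasFDerivAt (fun x => w x b) ((fderiv ℝ w z).flip b) z := fun z =>
      ((ContinuousLinearMap.apply ℝ E b).hasFDerivAt.comp z
          (hw.differentiable (by simp) z).hasFDerivAt)
    have h2 := Convex.norm_image_sub_le_of_norm_hasFDerivWithin_le (s := univ) (x := y) (y := x)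
      (fun z _ => (h1 z).hasFDerivWithinAt) (fun z _ => hsmall b hb z) convex_univ
      (mem_univ _) (mem_univ _)
    have h3 : T b x - T b y - ((ContinuousLinearEquiv.refl ℝ E : E ≃L[ℝ] E) : E →L[ℝ] E) (x - y) =
      w x b - w y b := by simp [T]; abel
    rw [h3]
    simpa using h2
  have hhom : ∀ b ∈ O, ∃ H : E ≃ₜ E, ⇑H = T b := by
    intro b hb
    refine ⟨(happ b hb).toHomeomorph (T b) ?_, rfl⟩
    rcases subsingleton_or_nontrivial E with h | h
    · exact Or.inl h
    · right
      have : ‖((ContinuousLinearEquiv.refl ℝ E).symm : E →L[ℝ] E)‖₊ = 1 := by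
        rw [← NNReal.coe_inj]
        simp
      rw [this, inv_one]
      exact NNReal.half_lt_self one_ne_zero
  -- An injective map fixing the complement of `D` sends `D` into `D`: a point leaving `D` would
  -- share its image with the fixed point it lands on.
  have hmaps : ∀ T' : E → E, Function.Injective T' → (∀ x ∉ D, T' x = x) →
      MapsTo T' e.target e.target := by
    intro T' hinj hT' x hx
    by_cases hxD : x ∈ D
    · refine hDe ?_
      by_contra hcon
      have := hinj (hT' _ hcon)
      rw [this] at hcon
      exact hcon hxD
    · rwa [hT' x hxD]
  have hTe : ∀ b ∈ O, MapsTo (T b) e.target e.target := by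
    intro b hb
    obtain ⟨H, hH⟩ := hhom b hb
    exact hmaps _ (hH ▸ H.injective) (hTD b)
  have hKc : IsCompact (Metric.closedBall (e x₀) R) := isCompact_closedBall _ _
  have hnotK : ∀ x ∉ Metric.closedBall (e x₀) R, x ∉ D := fun x hx h =>
    hx (Metric.ball_subset_closedBall h)
  have hsmooth := contMDiffOn_chartLift he hKc hRe (O := O) Metric.isOpen_ball hTs.contDiffOn
    (fun b _ x hx => hTD b x (hnotK x hx)) hTe
  have h0O : (0 : BoundedContinuousFunction ℕ E) ∈ O := Metric.mem_ball_self hδ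
  have hopen : IsOpen (e.source ∩ e ⁻¹' D) := e.isOpen_inter_preimage Metric.isOpen_ball
  refine ⟨e.source ∩ e ⁻¹' D, hopen.mem_nhds ⟨mem_chart_source E x₀, Metric.mem_ball_self hR⟩,
    hopen, fun b => chartLift e (T b), O, Metric.isOpen_ball, h0O, hsmooth, ?_, ?_, ?_⟩
  · intro b hb
    obtain ⟨H, hH⟩ := hhom b hb
    have hHs : ContDiff ℝ ∞ H := hH ▸ hTb b
    have hHi : ContDiff ℝ ∞ H.symm := contDiff_symm_toHomeomorph_of_norm_fderiv_le H hHs fun x => by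
      rw [hH, (hTd b x).fderiv, add_sub_cancel_left]
      exact hsmall b hb x
    have hHD : ∀ x ∉ D, H.symm x = x := fun x hx => by
      rw [H.symm_apply_eq, hH, hTD b x hx]
    have hHe := hmaps H.symm H.symm.injective hHD
    have hHe' : MapsTo H e.target e.target := hH ▸ hTe b hb
    have hslice : ContMDiff 𝓘(ℝ, E) (𝓘(ℝ, BoundedContinuousFunction ℕ E).prod 𝓘(ℝ, E)) ∞
        (fun x : L => (b, x)) := contMDiff_const.prodMk contMDiff_id
    refine ⟨⟨⟨chartLift e H, chartLift e H.symm, chartLift_comp hHe' H.symm_apply_apply,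
      chartLift_comp hHe H.apply_symm_apply⟩, ?_, ?_⟩, ?_⟩
    · rw [← contMDiffOn_univ]
      simp only [hH]
      exact hsmooth.comp hslice.contMDiffOn fun x _ => ⟨hb, mem_univ _⟩
    · rw [← contMDiffOn_univ]
      -- Only the single map `H.symm` is needed, so the parameter in `ℝ` is a dummy.
      have h := contMDiffOn_chartLift he hKc hRe (B := ℝ) isOpen_univ (T := fun _ => H.symm)
        (hHi.comp contDiff_snd).contDiffOn (fun _ _ x hx => hHD x (hnotK x hx)) (fun _ _ => hHe)
      have hslice' : ContMDiff 𝓘(ℝ, E) (𝓘(ℝ, ℝ).prod 𝓘(ℝ, E)) ∞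
        (fun x : L => ((0 : ℝ), x)) := contMDiff_const.prodMk contMDiff_id
      exact h.comp hslice'.contMDiffOn fun x _ => ⟨mem_univ _, mem_univ _⟩
    · funext x
      change chartLift e H x = _
      rw [hH]
  · intro x
    by_cases hx : x ∈ e.source
    · simp [chartLift_of_mem hx, T, e.left_inv hx]
    · exact chartLift_of_notMem hx
  · rintro b hb y ⟨hy, hyD⟩ F hF hyF ξ
    have : IsManifold 𝓘(ℝ, E) 1 L := IsManifold.of_le (n := ∞) (by simp)
    have hmd : e.MDifferentiable 𝓘(ℝ, E) 𝓘(ℝ, E) :=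
      mdifferentiable_of_mem_atlas (chart_mem_atlas E x₀)
    have hder : ∀ y ∈ e.source, HasMFDerivAt 𝓘(ℝ, BoundedContinuousFunction ℕ E) 𝓘(ℝ, E)
        (fun b => chartLift e (T b) y) b
        ((mfderiv 𝓘(ℝ, E) 𝓘(ℝ, E) e.symm (T b (e y))).comp (w (e y))) := by
      intro y hy
      have h1 : HasFDerivAt (fun b => T b (e y)) (w (e y)) b :=
        (w (e y)).hasFDerivAt.const_add (e y)
      have h2 := (hmd.mdifferentiableAt_symm (hTe b hb (e.map_source hy))).hasMFDerivAt
      have h3 := HasMFDerivAt.comp b h2 h1.hasMFDerivAt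
      refine h3.congr_of_eventuallyEq (Eventually.of_forall fun b => ?_)
      exact chartLift_of_mem hy
    have hinj : e y ∉ e '' (F ∩ e.source) := by
      rintro ⟨y', ⟨hy'F, hy'⟩, heq⟩
      exact hyF (e.injOn hy' hy heq ▸ hy'F)
    have hsurj : Function.Surjective (mfderiv 𝓘(ℝ, E) 𝓘(ℝ, E) e.symm (T b (e y))) :=
      hmd.symm.mfderiv_surjective (x := T b (e y)) (hTe b hb (e.map_source hy))
    obtain ⟨η, hη⟩ := hsurj ξ
    obtain ⟨b', hb', hb'F⟩ := hint (e y) hyD _ ((hF.inter_of_left _).image e) hinj η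
    refine ⟨b', ?_, fun y' hy' => ?_⟩
    · rw [(hder y hy).mfderiv]
      exact (congrArg (mfderiv 𝓘(ℝ, E) 𝓘(ℝ, E) e.symm (T b (e y))) hb').trans hη
    · by_cases hy's : y' ∈ e.source
      · rw [(hder y' hy's).mfderiv]
        exact (congrArg (mfderiv 𝓘(ℝ, E) 𝓘(ℝ, E) e.symm (T b (e y')))
          (hb'F _ ⟨y', ⟨hy', hy's⟩, rfl⟩)).trans (map_zero _)
      · have hc : HasMFDerivAt 𝓘(ℝ, BoundedContinuousFunction ℕ E) 𝓘(ℝ, E)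
            (fun b => chartLift e (T b) y') b 0 :=
          (hasMFDerivAt_const y' b).congr_of_eventuallyEq
            (Eventually.of_forall fun b => chartLift_of_notMem hy's)
        rw [hc.mfderiv]
        rfl

end Family

/-! ### Gluing local families by composition -/

section Composition

variable {E : Type} [NormedAddCommGroup E] [NormedSpace ℝ E]
  {L : Type*} [TopologicalSpace L] [ChartedSpace E L]
  {B B₁ B₂ : Type} [NormedAddCommGroup B] [NormedSpace ℝ B]
  [NormedAddCommGroup B₁] [NormedSpace ℝ B₁] [NormedAddCommGroup B₂] [NormedSpace ℝ B₂]

theorem IsDiffFamily.mono {φ : B → L → L} {O : Set B} {S S' : Set L}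
    (h : IsDiffFamily E φ O S) (hS : S' ⊆ S) : IsDiffFamily E φ O S' :=
  { h with interpolates := fun b hb y hy => h.interpolates b hb y (hS hy) }

theorem IsDiffFamily.mdifferentiableAt {φ : B → L → L} {O : Set B} {S : Set L}
    (h : IsDiffFamily E φ O S) {b : B} (hb : b ∈ O) (y : L) :
    MDifferentiableAt 𝓘(ℝ, B) 𝓘(ℝ, E) (fun b => φ b y) b := by
  have h1 := h.contMDiffOn.contMDiffAt ((h.isOpen.prod isOpen_univ).mem_nhds (mk_mem_prod hb (mem_univ y)))
  have h2 : ContMDiffAt 𝓘(ℝ, B) (𝓘(ℝ, B).prod 𝓘(ℝ, E)) ∞ (fun b : B => (b, y)) b :=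
    contMDiffAt_id.prodMk contMDiffAt_const
  exact (ContMDiffAt.comp b h1 h2).mdifferentiableAt (by simp)

theorem mfderiv_apply_inl {f : B₁ × B₂ → L} {b : B₁ × B₂}
    (hf : MDifferentiableAt 𝓘(ℝ, B₁ × B₂) 𝓘(ℝ, E) f b) (v : B₁) :
    mfderiv 𝓘(ℝ, B₁ × B₂) 𝓘(ℝ, E) f b ((v, 0) : B₁ × B₂) =
      mfderiv 𝓘(ℝ, B₁) 𝓘(ℝ, E) (fun c => f (c, b.2)) b.1 v := by
  have h : HasMFDerivAt 𝓘(ℝ, B₁) 𝓘(ℝ, B₁ × B₂) (fun c => (c, b.2)) b.1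
    (ContinuousLinearMap.inl ℝ B₁ B₂) := (hasFDerivAt_prodMk_left b.1 b.2).hasMFDerivAt
  exact (DFunLike.congr_fun (HasMFDerivAt.comp b.1 (g := f) hf.hasMFDerivAt h).mfderiv v).symm

theorem mfderiv_apply_inr {f : B₁ × B₂ → L} {b : B₁ × B₂}
    (hf : MDifferentiableAt 𝓘(ℝ, B₁ × B₂) 𝓘(ℝ, E) f b) (v : B₂) :
    mfderiv 𝓘(ℝ, B₁ × B₂) 𝓘(ℝ, E) f b ((0, v) : B₁ × B₂) =
      mfderiv 𝓘(ℝ, B₂) 𝓘(ℝ, E) (fun c => f (b.1, c)) b.2 v := by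
  have h : HasMFDerivAt 𝓘(ℝ, B₂) 𝓘(ℝ, B₁ × B₂) (fun c => (b.1, c)) b.2
    (ContinuousLinearMap.inr ℝ B₁ B₂) := (hasFDerivAt_prodMk_right b.1 b.2).hasMFDerivAt
  exact (DFunLike.congr_fun (HasMFDerivAt.comp b.2 (g := f) hf.hasMFDerivAt h).mfderiv v).symm

/-- Composing two families of diffeomorphisms. -/
theorem IsDiffFamily.exists_comp {φ₁ : B₁ → L → L} {O₁ : Set B₁} {S₁ : Set L}
    (h₁ : IsDiffFamily E φ₁ O₁ S₁) {φ₂ : B₂ → L → L} {O₂ : Set B₂} {S₂ : Set L}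
    (h₂ : IsDiffFamily E φ₂ O₂ S₂) (hS₁ : IsOpen S₁) {K : Set L} (hK : IsCompact K)
    (hKS : K ⊆ S₁) :
    ∃ O, IsDiffFamily E (fun (b : B₁ × B₂) x => φ₁ b.1 (φ₂ b.2 x)) O (K ∪ S₂) := by
  -- The outer family acts at `φ₂ b y`, which must stay in `S₁`. Compactness of `K` secures this for
  -- small `b`.
  have hev : ∀ᶠ b in 𝓝 (0 : B₂), ∀ y ∈ K, φ₂ b y ∈ S₁ := by
    refine hK.eventually_forall_of_forall_eventually fun y hy => ?_
    have hc : ContinuousAt (fun z : B₂ × L => φ₂ z.1 z.2) (0, y) :=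
      h₂.contMDiffOn.continuousOn.continuousAt
        ((h₂.isOpen.prod isOpen_univ).mem_nhds ⟨h₂.zero_mem, mem_univ y⟩)
    refine hc.preimage_mem_nhds (hS₁.mem_nhds ?_)
    simpa [h₂.zero_apply] using hKS hy
  obtain ⟨V, hV, hVo, hV0⟩ := _root_.mem_nhds_iff.1 hev
  have hsm : ContMDiffOn (𝓘(ℝ, B₁ × B₂).prod 𝓘(ℝ, E)) 𝓘(ℝ, E) ∞
      (fun z : (B₁ × B₂) × L => φ₁ z.1.1 (φ₂ z.1.2 z.2)) ((O₁ ×ˢ (O₂ ∩ V)) ×ˢ univ) := by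
    have hf1 : ContMDiff (𝓘(ℝ, B₁ × B₂).prod 𝓘(ℝ, E)) 𝓘(ℝ, B₁) ∞
        (fun z : (B₁ × B₂) × L => z.1.1) :=
      (contDiff_fst (𝕜 := ℝ) (E := B₁) (F := B₂)).contMDiff.comp contMDiff_fst
    have hf2 : ContMDiff (𝓘(ℝ, B₁ × B₂).prod 𝓘(ℝ, E)) 𝓘(ℝ, B₂) ∞
        (fun z : (B₁ × B₂) × L => z.1.2) :=
      (contDiff_snd (𝕜 := ℝ) (E := B₁) (F := B₂)).contMDiff.comp contMDiff_fst
    have hin : ContMDiffOn (𝓘(ℝ, B₁ × B₂).prod 𝓘(ℝ, E)) 𝓘(ℝ, E) ∞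
        (fun z : (B₁ × B₂) × L => φ₂ z.1.2 z.2) ((O₁ ×ˢ (O₂ ∩ V)) ×ˢ univ) :=
      h₂.contMDiffOn.comp (hf2.prodMk contMDiff_snd).contMDiffOn
        fun z hz => ⟨hz.1.2.1, mem_univ _⟩
    exact h₁.contMDiffOn.comp (hf1.contMDiffOn.prodMk hin) fun z hz => ⟨hz.1.1, mem_univ _⟩
  have hOo : IsOpen (O₁ ×ˢ (O₂ ∩ V)) := h₁.isOpen.prod (h₂.isOpen.inter hVo)
  refine ⟨O₁ ×ˢ (O₂ ∩ V), hOo, ⟨h₁.zero_mem, h₂.zero_mem, hV0⟩, hsm, ?_, ?_, ?_⟩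
  · rintro b ⟨hb₁, hb₂, -⟩
    obtain ⟨ψ₁, hψ₁⟩ := h₁.exists_diffeomorph b.1 hb₁
    obtain ⟨ψ₂, hψ₂⟩ := h₂.exists_diffeomorph b.2 hb₂
    exact ⟨ψ₂.trans ψ₁, by rw [Diffeomorph.coe_trans, hψ₁, hψ₂]; rfl⟩
  · intro x
    simp [h₁.zero_apply, h₂.zero_apply]
  · rintro ⟨b₁, b₂⟩ hb y hy F hF hyF ξ
    obtain ⟨hb₁, hb₂, hbV⟩ := hb
    have hd : ∀ y', MDifferentiableAt 𝓘(ℝ, B₁ × B₂) 𝓘(ℝ, E)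
        (fun b : B₁ × B₂ => φ₁ b.1 (φ₂ b.2 y')) (b₁, b₂) := by
      intro y'
      have h1 := hsm.contMDiffAt ((hOo.prod isOpen_univ).mem_nhds
        (mk_mem_prod (mk_mem_prod hb₁ ⟨hb₂, hbV⟩) (mem_univ y')))
      have h2 : ContMDiffAt 𝓘(ℝ, B₁ × B₂) (𝓘(ℝ, B₁ × B₂).prod 𝓘(ℝ, E)) ∞
        (fun b : B₁ × B₂ => (b, y')) (b₁, b₂) := contMDiffAt_id.prodMk contMDiffAt_const
      exact (ContMDiffAt.comp (b₁, b₂) h1 h2).mdifferentiableAt (by simp)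
    obtain ⟨ψ₁, hψ₁⟩ := h₁.exists_diffeomorph b₁ hb₁
    obtain ⟨ψ₂, hψ₂⟩ := h₂.exists_diffeomorph b₂ hb₂
    -- Over `K` only the outer parameter is varied. Over `S₂` only the inner one is, and its
    -- velocities are transported by the invertible differential of `φ₁ b₁`.
    rcases hy with hy | hy
    · have hyF' : φ₂ b₂ y ∉ φ₂ b₂ '' F := by
        rintro ⟨y', hy', heq⟩
        rw [← hψ₂] at heq
        exact hyF (ψ₂.injective heq ▸ hy')
      obtain ⟨v, hv, hvF⟩ := h₁.interpolates b₁ hb₁ _ (hV hbV y hy) _ (hF.image _) hyF' ξ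
      refine ⟨(v, 0), ?_, fun y' hy' => ?_⟩
      · exact (mfderiv_apply_inl (hd y) v).trans hv
      · exact (mfderiv_apply_inl (hd y') v).trans (hvF _ ⟨y', hy', rfl⟩)
    · have hψd : ∀ x, MDifferentiableAt 𝓘(ℝ, E) 𝓘(ℝ, E) (φ₁ b₁) x := fun x =>
        hψ₁ ▸ ψ₁.contMDiff.mdifferentiable (by simp) x
      have hsurj : Function.Surjective (mfderiv 𝓘(ℝ, E) 𝓘(ℝ, E) (φ₁ b₁) (φ₂ b₂ y)) := by
        rw [← hψ₁]
        exact (ψ₁.mfderivToContinuousLinearEquiv (by simp) _).surjective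
      have hcomp : ∀ y' v, mfderiv 𝓘(ℝ, B₂) 𝓘(ℝ, E) (fun c => φ₁ b₁ (φ₂ c y')) b₂ v =
          mfderiv 𝓘(ℝ, E) 𝓘(ℝ, E) (φ₁ b₁) (φ₂ b₂ y')
            (mfderiv 𝓘(ℝ, B₂) 𝓘(ℝ, E) (fun c => φ₂ c y') b₂ v) := fun y' v => by
        have := (HasMFDerivAt.comp b₂ (hψd (φ₂ b₂ y')).hasMFDerivAt
          (h₂.mdifferentiableAt hb₂ y').hasMFDerivAt).mfderiv
        exact DFunLike.congr_fun this v
      obtain ⟨η, hη⟩ := hsurj ξ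
      obtain ⟨v, hv, hvF⟩ := h₂.interpolates b₂ hb₂ y hy F hF hyF η
      refine ⟨(0, v), ?_, fun y' hy' => ?_⟩
      · exact ((mfderiv_apply_inr (hd y) v).trans (hcomp y v)).trans
          ((congrArg (mfderiv 𝓘(ℝ, E) 𝓘(ℝ, E) (φ₁ b₁) (φ₂ b₂ y)) hv).trans hη)
      · exact ((mfderiv_apply_inr (hd y') v).trans (hcomp y' v)).trans
          ((congrArg (mfderiv 𝓘(ℝ, E) 𝓘(ℝ, E) (φ₁ b₁) (φ₂ b₂ y')) (hvF y' hy')).trans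
            (map_zero _))

variable (E L) in
/-- On a compact manifold some smooth family of diffeomorphisms, parametrised by a Banach space,
moves all points independently. -/
theorem exists_isDiffFamily_univ [FiniteDimensional ℝ E] [IsManifold 𝓘(ℝ, E) ∞ L] [T2Space L]
    [CompactSpace L] :
    ∃ (B : Type) (_ : NormedAddCommGroup B) (_ : NormedSpace ℝ B) (_ : CompleteSpace B)
      (φ : B → L → L) (O : Set B), IsDiffFamily E φ O univ := by
  have : CompleteSpace E := FiniteDimensional.complete ℝ E
  -- The open `S'` around `closure S` leaves room in the induction for the compact set on which
  -- `exists_comp` retains the outer family.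
  suffices h : ∃ (B : Type) (_ : NormedAddCommGroup B) (_ : NormedSpace ℝ B) (_ : CompleteSpace B)
      (φ : B → L → L) (O : Set B) (S' : Set L), IsOpen S' ∧ closure univ ⊆ S' ∧
        IsDiffFamily E φ O S' by
    obtain ⟨B, i₁, i₂, i₃, φ, O, S', -, hS', hφ⟩ := h
    exact ⟨B, i₁, i₂, i₃, φ, O, hφ.mono (subset_closure.trans hS')⟩
  refine (isCompact_univ (X := L)).induction_on (p := fun S => ∃ (B : Type)
    (_ : NormedAddCommGroup B) (_ : NormedSpace ℝ B) (_ : CompleteSpace B) (φ : B → L → L)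
    (O : Set B) (S' : Set L), IsOpen S' ∧ closure S ⊆ S' ∧ IsDiffFamily E φ O S') ?_ ?_ ?_ ?_
  · refine ⟨ℝ, inferInstance, inferInstance, inferInstance, fun _ x => x, univ, ∅, isOpen_empty,
      by simp, isOpen_univ, mem_univ _, contMDiffOn_snd, fun _ _ => ⟨Diffeomorph.refl _ _ _, rfl⟩,
      fun _ => rfl, fun _ _ _ h => h.elim⟩
  · rintro S T hST ⟨B, i₁, i₂, i₃, φ, O, S', h1, h2, h3⟩
    exact ⟨B, i₁, i₂, i₃, φ, O, S', h1, (closure_mono hST).trans h2, h3⟩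
  · rintro S T ⟨B₁, i₁, i₂, i₃, φ₁, O₁, S', h1, h2, h3⟩ ⟨B₂, j₁, j₂, j₃, φ₂, O₂, T', k1, k2, k3⟩
    obtain ⟨u, hu, hSu, huS⟩ := normal_exists_closure_subset isClosed_closure h1 h2
    obtain ⟨O, hO⟩ := h3.exists_comp k3 h1 (isClosed_closure (s := u)).isCompact huS
    refine ⟨B₁ × B₂, inferInstance, inferInstance, inferInstance, _, O, u ∪ T', hu.union k1, ?_,
      hO.mono (union_subset_union_left _ subset_closure)⟩
    rw [closure_union]
    exact union_subset_union hSu k2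
  · intro x _
    obtain ⟨S, hS, hSo, φ, O, h⟩ := exists_isDiffFamily_nhds (E := E) x
    obtain ⟨t, ht, htc, htS⟩ := exists_mem_nhds_isClosed_subset hS
    exact ⟨t, mem_nhdsWithin_of_mem_nhds ht, _, inferInstance, inferInstance, inferInstance, φ, O,
      S, hSo, by rwa [htc.closure_eq], h⟩

end Composition

/-! ### Continuity of the family at `0` in the smooth topology -/

section SmoothTopology

variable {E : Type} [NormedAddCommGroup E] [NormedSpace ℝ E]
  {L : Type*} [TopologicalSpace L] [ChartedSpace E L]
  {B : Type} [NormedAddCommGroup B] [NormedSpace ℝ B]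

/-- The slice derivative is the total derivative restricted to the second factor, again smooth in
both variables. The induction applies to it, so the codomain must vary. -/
theorem continuousOn_iteratedFDeriv_slice (k : ℕ) : ∀ {G : Type} [NormedAddCommGroup G]
    [NormedSpace ℝ G] {Ω : Set (B × E)} (_ : IsOpen Ω) {H : B × E → G} (_ : ContDiffOn ℝ ∞ H Ω),
    ContinuousOn (fun z : B × E => iteratedFDeriv ℝ k (fun x => H (z.1, x)) z.2) Ω := by
  induction k with
  | zero =>
    intro G _ _ Ω hΩ H hH
    simp only [iteratedFDeriv_zero_eq_comp]
    exact (LinearIsometryEquiv.continuous _).comp_continuousOn hH.continuousOn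
  | succ k ih =>
    intro G _ _ Ω hΩ H hH
    have hH' : ContDiffOn ℝ ∞ (fun z => (fderiv ℝ H z).comp (ContinuousLinearMap.inr ℝ B E)) Ω :=
      (hH.fderiv_of_isOpen hΩ (by simp)).clm_comp contDiffOn_const
    simp only [iteratedFDeriv_succ_eq_comp_right]
    refine (LinearIsometryEquiv.continuous _).comp_continuousOn ((ih hΩ hH').congr fun z hz => ?_)
    refine Filter.EventuallyEq.eq_of_nhds (Filter.EventuallyEq.iteratedFDeriv (𝕜 := ℝ) ?_ k)
    have hc : Continuous fun x : E => (z.1, x) := by fun_prop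
    filter_upwards [(hΩ.preimage hc).mem_nhds (x := z.2) hz] with x hx
    exact (fderiv_slice ((hH.contDiffAt (hΩ.mem_nhds hx)).differentiableAt (by simp))).fderiv

/-- As `φ 0 = id`, the strict inequalities hold at `b = 0` by `hid`. Joint continuity of the
derivatives and compactness of `K` spread them to small `b`. -/
theorem IsDiffFamily.eventually_mem_smoothBasicSet {φ : B → L → L} {O : Set B} {S : Set L}
    (h : IsDiffFamily E φ O S) (f : C^∞⟮𝓘(ℝ, E), L; 𝓘(ℝ, E), L⟯)
    {e e' : OpenPartialHomeomorph L E} (he : e ∈ IsManifold.maximalAtlas 𝓘(ℝ, E) ∞ L)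
    (he' : e' ∈ IsManifold.maximalAtlas 𝓘(ℝ, E) ∞ L) {K : Set L} (hK : IsCompact K)
    (hKe : K ⊆ e.source) (hf : MapsTo f K e'.source) (r : ℕ) {ε : ℝ}
    (hid : ContMDiffMap.id ∈ smoothBasicSet f e e' K r ε) :
    ∀ᶠ b in 𝓝 (0 : B), ∀ g : C^∞⟮𝓘(ℝ, E), L; 𝓘(ℝ, E), L⟯, ⇑g = φ b →
      g ∈ smoothBasicSet f e e' K r ε := by
  have hφc := h.contMDiffOn.continuousOn
  set Ω : Set (B × E) := (O ×ˢ e.target) ∩ (fun z => φ z.1 (e.symm z.2)) ⁻¹' e'.source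
  have hes : ContMDiffOn 𝓘(ℝ, B × E) (𝓘(ℝ, B).prod 𝓘(ℝ, E)) ∞
      (fun z : B × E => (z.1, e.symm z.2)) (O ×ˢ e.target) := by
    have h1 : ContMDiff 𝓘(ℝ, B × E) 𝓘(ℝ, B) ∞ (fun z : B × E => z.1) := contDiff_fst.contMDiff
    have h2 : ContMDiff 𝓘(ℝ, B × E) 𝓘(ℝ, E) ∞ (fun z : B × E => z.2) := contDiff_snd.contMDiff
    exact h1.contMDiffOn.prodMk
      ((contMDiffOn_symm_of_mem_maximalAtlas he).comp h2.contMDiffOn fun z hz => hz.2)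
  have hφe : ContMDiffOn 𝓘(ℝ, B × E) 𝓘(ℝ, E) ∞ (fun z : B × E => φ z.1 (e.symm z.2))
      (O ×ˢ e.target) :=
    h.contMDiffOn.comp hes fun z hz => ⟨hz.1, mem_univ _⟩
  have hΩ : IsOpen Ω := hφe.continuousOn.isOpen_inter_preimage (h.isOpen.prod e.open_target)
    e'.open_source
  have hH : ContDiffOn ℝ ∞ (fun z : B × E => e' (φ z.1 (e.symm z.2))) Ω := by
    rw [← contMDiffOn_iff_contDiffOn]
    exact (contMDiffOn_of_mem_maximalAtlas he').comp (hφe.mono inter_subset_left)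
      fun z hz => hz.2
  set Ω' : Set E := e.target ∩ (fun z => f (e.symm z)) ⁻¹' e'.source
  have hfe : ContMDiffOn 𝓘(ℝ, E) 𝓘(ℝ, E) ∞ (fun z : E => f (e.symm z)) e.target :=
    f.contMDiff.comp_contMDiffOn (contMDiffOn_symm_of_mem_maximalAtlas he)
  have hΩ' : IsOpen Ω' := hfe.continuousOn.isOpen_inter_preimage e.open_target e'.open_source
  have hfs : ContDiffOn ℝ ∞ (e' ∘ f ∘ e.symm) Ω' := by
    rw [← contMDiffOn_iff_contDiffOn]
    exact (contMDiffOn_of_mem_maximalAtlas he').comp (hfe.mono inter_subset_left)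
      fun z hz => hz.2
  have key : ∀ᶠ b in 𝓝 (0 : B), ∀ x ∈ K, φ b x ∈ e'.source ∧ ∀ k ∈ Finset.range (r + 1),
      ‖iteratedFDeriv ℝ k (e' ∘ f ∘ e.symm) (e x) -
        iteratedFDeriv ℝ k (fun z => e' (φ b (e.symm z))) (e x)‖ < ε := by
    refine hK.eventually_forall_of_forall_eventually fun x hx => ?_
    have hx0 : φ 0 x ∈ e'.source := by
      rw [h.zero_apply]
      exact hid.1 hx
    refine Filter.Eventually.and ?_ ((Finset.eventually_all _).2 fun k hk => ?_)
    · exact (hφc.continuousAt ((h.isOpen.prod isOpen_univ).mem_nhds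
        ⟨h.zero_mem, mem_univ x⟩)).preimage_mem_nhds (e'.open_source.mem_nhds hx0)
    · have hex : ContinuousAt (fun z : B × L => (z.1, e z.2)) (0, x) :=
        continuousAt_fst.prodMk ((e.continuousAt (hKe hx)).comp continuousAt_snd)
      have hxΩ : ((0 : B), e x) ∈ Ω := by
        refine ⟨⟨h.zero_mem, e.map_source (hKe hx)⟩, ?_⟩
        simpa only [mem_preimage, e.left_inv (hKe hx)] using hx0
      have hxΩ' : e x ∈ Ω' := by
        refine ⟨e.map_source (hKe hx), ?_⟩
        simpa only [mem_preimage, e.left_inv (hKe hx)] using hf hx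
      have c1 : ContinuousAt (fun z : B × L =>
          iteratedFDeriv ℝ k (fun y => e' (φ z.1 (e.symm y))) (e z.2)) (0, x) :=
        ContinuousAt.comp (f := fun z : B × L => (z.1, e z.2)) (x := ((0 : B), x))
          ((continuousOn_iteratedFDeriv_slice k hΩ hH).continuousAt (hΩ.mem_nhds hxΩ)) hex
      have c2 : ContinuousAt (fun z : B × L =>
          iteratedFDeriv ℝ k (e' ∘ f ∘ e.symm) (e z.2)) (0, x) := by
        have h1 : ContinuousAt (iteratedFDeriv ℝ k (e' ∘ f ∘ e.symm)) (e x) :=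
          ((hfs.contDiffAt (hΩ'.mem_nhds hxΩ')).iteratedFDeriv_right (i := k) (m := 0)
            (by exact_mod_cast le_top)).continuousAt
        exact ContinuousAt.comp (f := fun z : B × L => e z.2) (x := ((0 : B), x)) h1
          ((e.continuousAt (hKe hx)).comp continuousAt_snd)
      refine (c2.sub c1).norm.eventually_lt_const ?_
      have := hid.2 x hx k (Nat.lt_succ_iff.1 (Finset.mem_range.1 hk))
      change ‖iteratedFDeriv ℝ k (e' ∘ f ∘ e.symm) (e x) -
        iteratedFDeriv ℝ k (fun y => e' (φ 0 (e.symm y))) (e x)‖ < ε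
      simp only [h.zero_apply]
      exact this
  filter_upwards [key] with b hb g hg
  refine ⟨fun x hx => ?_, fun x hx k hk => ?_⟩
  · rw [hg]
    exact (hb x hx).1
  · rw [hg]
    exact (hb x hx).2 k (Finset.mem_range.2 (Nat.lt_succ_of_le hk))

theorem IsDiffFamily.eventually_mem {φ : B → L → L} {O : Set B} {S : Set L}
    (h : IsDiffFamily E φ O S) {𝒰 : Set C^∞⟮𝓘(ℝ, E), L; 𝓘(ℝ, E), L⟯}
    (h𝒰 : IsOpen[smoothTopology L L] 𝒰) (hid : ContMDiffMap.id ∈ 𝒰) :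
    ∀ᶠ b in 𝓝 (0 : B), ∀ g : C^∞⟮𝓘(ℝ, E), L; 𝓘(ℝ, E), L⟯, ⇑g = φ b → g ∈ 𝒰 := by
  classical
  -- Outside `O` the identity serves as a default value, invisible to the limit at `0`.
  have hex : ∀ b, ∃ g : C^∞⟮𝓘(ℝ, E), L; 𝓘(ℝ, E), L⟯, b ∈ O → ⇑g = φ b := fun b => by
    by_cases hb : b ∈ O
    · obtain ⟨ψ, hψ⟩ := h.exists_diffeomorph b hb
      exact ⟨ψ.toContMDiffMap, fun _ => hψ⟩
    · exact ⟨ContMDiffMap.id, fun h => absurd h hb⟩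
  choose Φ hΦ using hex
  have ht : Tendsto Φ (𝓝 0) (@nhds _ (smoothTopology L L) ContMDiffMap.id) := by
    rw [TopologicalSpace.tendsto_nhds_generateFrom_iff]
    rintro W ⟨f, e, e', K, r, ε, he, he', hK, hKe, hf, hε, rfl⟩ hW
    filter_upwards [h.eventually_mem_smoothBasicSet f he he' hK hKe hf r hW,
      h.isOpen.mem_nhds h.zero_mem] with b hb hbO
    exact hb _ (hΦ b hbO)
  have hmem : 𝒰 ∈ @nhds _ (smoothTopology L L) ContMDiffMap.id := by
    let _ := smoothTopology (E := E) (F := E) L L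
    exact IsOpen.mem_nhds h𝒰 hid
  filter_upwards [ht hmem,
    h.isOpen.mem_nhds h.zero_mem] with b hb hbO g hg
  have : g = Φ b := ContMDiffMap.coe_injective (hg.trans (hΦ b hbO).symm)
  rw [this]
  exact hb

end SmoothTopology

/-! ### The power `L^s` as a manifold -/

section Pi

variable (E : Type) [NormedAddCommGroup E] [NormedSpace ℝ E] (s : ℕ)

/-- The model of the power `L^s` of a manifold modelled on `E`. -/
noncomputable abbrev powModel : ModelWithCorners ℝ (Fin s → E) (ModelPi fun _ : Fin s => E) :=
  ModelWithCorners.pi fun _ : Fin s => 𝓘(ℝ, E)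

theorem range_powModel : range (powModel E s) = univ :=
  range_eq_univ.2 fun x => ⟨x, rfl⟩

theorem powModel_boundaryless : (powModel E s).Boundaryless := ⟨range_powModel E s⟩

variable {E s} {L : Type*} [TopologicalSpace L] [ChartedSpace E L]

theorem isManifold_pow [IsManifold 𝓘(ℝ, E) ∞ L] : IsManifold (powModel E s) ∞ (Fin s → L) := by
  refine isManifold_of_contDiffOn _ _ _ ?_
  rintro _ _ ⟨f, hf, rfl⟩ ⟨g, hg, rfl⟩
  rw [contDiffOn_pi]
  intro i
  have h := (contDiffGroupoid ∞ 𝓘(ℝ, E)).compatible (hf i (mem_univ i)) (hg i (mem_univ i))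
  rw [contDiffGroupoid, mem_groupoid_of_pregroupoid] at h
  have h1 : ContDiffOn ℝ ∞ ((f i).symm.trans (g i)) ((f i).symm.trans (g i)).source := by
    simpa [contDiffPregroupoid] using h.1
  refine h1.comp (contDiff_apply ℝ E i).contDiffOn ?_
  rintro z ⟨hz, -⟩
  exact ⟨hz.1 i (mem_univ i), hz.2 i (mem_univ i)⟩

theorem mem_extChartAt_pow_source {q y : Fin s → L} :
    y ∈ (extChartAt (powModel E s) q).source ↔ ∀ i, y i ∈ (extChartAt 𝓘(ℝ, E) (q i)).source := by
  simp only [extChartAt_source]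
  exact ⟨fun h i => h i (mem_univ i), fun h i _ => h i⟩

theorem contMDiff_apply_pow (i : Fin s) :
    ContMDiff (powModel E s) 𝓘(ℝ, E) ∞ (fun y : Fin s → L => y i) := by
  intro q
  rw [contMDiffAt_iff]
  refine ⟨(continuous_apply i).continuousAt, ?_⟩
  refine (contDiff_apply ℝ E i).contDiffWithinAt.congr_of_eventuallyEq ?_ ?_
  · filter_upwards [extChartAt_target_mem_nhdsWithin q] with z hz
    have := congrFun ((extChartAt (powModel E s) q).right_inv hz) i
    exact this
  · exact congrFun ((extChartAt (powModel E s) q).right_inv (mem_extChartAt_target q)) i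

variable {E' H' P : Type*} [NormedAddCommGroup E'] [NormedSpace ℝ E'] [TopologicalSpace H']
  {I : ModelWithCorners ℝ E' H'} [TopologicalSpace P] [ChartedSpace H' P]

theorem contMDiffAt_pow [IsManifold 𝓘(ℝ, E) ∞ L] {f : P → Fin s → L} {p : P}
    (h : ∀ i, ContMDiffAt I 𝓘(ℝ, E) ∞ (fun p => f p i) p) :
    ContMDiffAt I (powModel E s) ∞ f p := by
  rw [contMDiffAt_iff_target]
  refine ⟨continuousAt_pi.2 fun i => (h i).continuousAt, ?_⟩
  rw [contMDiffAt_pi_space]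
  intro i
  exact ((contMDiffAt_iff_target).1 (h i)).2

end Pi

/-! ### Submersivity of the family on tuples of distinct points -/

section Local

variable {E : Type} [NormedAddCommGroup E] [NormedSpace ℝ E] {s : ℕ}
  {L : Type*} [TopologicalSpace L] [ChartedSpace E L] [IsManifold 𝓘(ℝ, E) ∞ L]
  {B : Type} [NormedAddCommGroup B] [NormedSpace ℝ B]

/-- A family of diffeomorphisms moves the tuples of distinct points submersively. -/
theorem IsDiffFamily.exists_hasFDerivAt_pow {φ : B → L → L} {O : Set B}
    (h : IsDiffFamily E φ O univ) {b : B} (hb : b ∈ O) {y : Fin s → L}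
    (hy : Function.Injective y) (q : Fin s → L)
    (hq : powMap s (φ b) y ∈ (extChartAt (powModel E s) q).source) :
    ∃ A : B →L[ℝ] (Fin s → E), Function.Surjective A ∧
      HasFDerivAt (fun b => extChartAt (powModel E s) q (powMap s (φ b) y)) A b := by
  have : IsManifold 𝓘(ℝ, E) 1 L := IsManifold.of_le (n := ∞) (by simp)
  rw [mem_extChartAt_pow_source] at hq
  set c : ∀ i, TangentSpace 𝓘(ℝ, E) (φ b (y i)) →L[ℝ] E := fun i =>
    mfderiv 𝓘(ℝ, E) 𝓘(ℝ, E) (extChartAt 𝓘(ℝ, E) (q i)) (φ b (y i))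
  set a : ∀ i, B →L[ℝ] TangentSpace 𝓘(ℝ, E) (φ b (y i)) := fun i =>
    mfderiv 𝓘(ℝ, B) 𝓘(ℝ, E) (fun b => φ b (y i)) b
  have hc : ∀ i, HasMFDerivAt 𝓘(ℝ, E) 𝓘(ℝ, E) (extChartAt 𝓘(ℝ, E) (q i)) (φ b (y i)) (c i) :=
    fun i => (mdifferentiableAt_extChartAt (by
      rw [← extChartAt_source 𝓘(ℝ, E)]
      exact hq i)).hasMFDerivAt
  have hcs : ∀ i, Function.Surjective (c i) := fun i =>
    (isInvertible_mfderiv_extChartAt (hq i)).surjective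
  have ha : ∀ i, HasMFDerivAt 𝓘(ℝ, B) 𝓘(ℝ, E) (fun b => φ b (y i)) b (a i) := fun i =>
    (h.mdifferentiableAt hb (y i)).hasMFDerivAt
  have hca : ∀ i, HasFDerivAt (fun b => extChartAt 𝓘(ℝ, E) (q i) (φ b (y i)))
      ((c i).comp (a i) : B →L[ℝ] E) b := fun i =>
    (HasMFDerivAt.comp b (hc i) (ha i)).hasFDerivAt
  refine ⟨ContinuousLinearMap.pi fun i => ((c i).comp (a i) : B →L[ℝ] E), fun η => ?_,
    hasFDerivAt_pi.2 hca⟩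
  choose ζ hζ using fun i => hcs i (η i)
  -- Since the entries of `y` are distinct, each can be moved with the others at rest. The sum of
  -- these directions realises all velocities at once.
  have hex : ∀ i, ∃ b' : B, a i b' = ζ i ∧ ∀ j, j ≠ i → a j b' = 0 := fun i => by
    obtain ⟨b', h1, h2⟩ := h.interpolates b hb (y i) (mem_univ _) (y '' {j | j ≠ i})
      (Set.toFinite _) (by
        rintro ⟨j, hj, hji⟩
        exact hj (hy hji)) (ζ i)
    exact ⟨b', h1, fun j hj => h2 _ ⟨j, hj, rfl⟩⟩
  choose b' hb₁ hb₂ using hex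
  refine ⟨∑ i, b' i, funext fun j => ?_⟩
  have hsum : a j (∑ i, b' i) = ζ j := by
    rw [map_sum, Finset.sum_eq_single j, hb₁]
    · exact fun i _ hij => hb₂ i j hij.symm
    · simp
  change c j (a j (∑ i, b' i)) = η j
  rw [hsum, hζ]

end Local

/-! ### Local genericity of transversality -/

section LocalTransversality

variable {E : Type} [NormedAddCommGroup E] [NormedSpace ℝ E] {s : ℕ}
  {L : Type*} [TopologicalSpace L] [ChartedSpace E L]
  {B : Type} [NormedAddCommGroup B] [NormedSpace ℝ B]
  {E' : Type} [NormedAddCommGroup E'] [NormedSpace ℝ E']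
  {P : Type*} [TopologicalSpace P] [ChartedSpace E' P] [IsManifold 𝓘(ℝ, E') ∞ P]

theorem mem_tangentVectors {R : Set (Fin s → L)} {x : Fin s → L} {γ : ℝ → Fin s → L} {ε : ℝ}
    (hε : 0 < ε) (hγ : ContMDiffOn 𝓘(ℝ, ℝ) (powModel E s) ∞ γ (Ioo (-ε) ε))
    (hγR : MapsTo γ (Ioo (-ε) ε) R) (h0 : γ 0 = x) {v : Fin s → E}
    (hv : mfderiv 𝓘(ℝ, ℝ) (powModel E s) γ 0 (1 : ℝ) = v) :
    (v : TangentSpace (powModel E s) x) ∈ tangentVectors (powModel E s) R x := by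
  subst h0 hv
  exact ⟨γ, ε, hε, hγ, hγR, rfl⟩

variable [IsManifold 𝓘(ℝ, E) ∞ L]

theorem IsDiffFamily.contMDiffOn_powMap {φ : B → L → L} {O : Set B} {S : Set L}
    (h : IsDiffFamily E φ O S) {X : Type} [NormedAddCommGroup X] [NormedSpace ℝ X]
    {σ : X → Fin s → L} {W : Set X} (hσ : ContMDiffOn 𝓘(ℝ, X) (powModel E s) ∞ σ W)
    (hW : IsOpen W) :
    ContMDiffOn 𝓘(ℝ, B × X) (powModel E s) ∞ (fun z : B × X => powMap s (φ z.1) (σ z.2))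
      (O ×ˢ W) := by
  rintro ⟨b, v⟩ ⟨hb, hv⟩
  refine (contMDiffAt_pow fun i => ?_).contMDiffWithinAt
  have h1 : ContMDiffAt 𝓘(ℝ, B × X) 𝓘(ℝ, B) ∞ (fun z : B × X => z.1) (b, v) :=
    contDiffAt_fst.contMDiffAt
  have h2 : ContMDiffAt 𝓘(ℝ, B × X) 𝓘(ℝ, X) ∞ (fun z : B × X => z.2) (b, v) :=
    contDiffAt_snd.contMDiffAt
  have h3 : ContMDiffAt 𝓘(ℝ, B × X) 𝓘(ℝ, E) ∞ (fun z : B × X => σ z.2 i) (b, v) :=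
    ((contMDiff_apply_pow i).contMDiffAt).comp (b, v)
      (ContMDiffAt.comp (b, v) (hσ.contMDiffAt (hW.mem_nhds hv)) h2)
  exact ContMDiffAt.comp (b, v) (g := fun z : B × L => φ z.1 z.2)
    (h.contMDiffOn.contMDiffAt ((h.isOpen.prod isOpen_univ).mem_nhds
      (mk_mem_prod hb (mem_univ (σ v i))))) (h1.prodMk h3)

/-- Transversality read off from a chart `χ` of the target, a chart of the source and a
parametrisation `σ` of the submanifold. -/
theorem range_mfderiv_add_tangentVectors_eq_univ {R : Set (Fin s → L)} {f : P → Fin s → L} {p : P}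
    {V : Type} [NormedAddCommGroup V] [NormedSpace ℝ V] {σ : V → Fin s → L} {W : Set V}
    (hf : MDifferentiableAt 𝓘(ℝ, E') (powModel E s) f p)
    (hW : IsOpen W) (hσ : ContMDiffOn 𝓘(ℝ, V) (powModel E s) ∞ σ W) (hσR : MapsTo σ W R)
    {v : V} (hv : v ∈ W) (hpv : f p = σ v) {q : Fin s → L}
    (hq : f p ∈ (extChartAt (powModel E s) q).source)
    {p₀ : P} (hp : p ∈ (extChartAt 𝓘(ℝ, E') p₀).source)
    {A : E' × V →L[ℝ] (Fin s → E)} (hA : Function.Surjective A)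
    (hder : HasFDerivAt (fun x : E' × V =>
      extChartAt (powModel E s) q (f ((extChartAt 𝓘(ℝ, E') p₀).symm x.1)) -
        extChartAt (powModel E s) q (σ x.2)) A (extChartAt 𝓘(ℝ, E') p₀ p, v)) :
    Set.range (mfderiv 𝓘(ℝ, E') (powModel E s) f p) +
      tangentVectors (powModel E s) R (f p) = Set.univ := by
  have : IsManifold (powModel E s) ∞ (Fin s → L) := isManifold_pow
  have : IsManifold (powModel E s) 1 (Fin s → L) := IsManifold.of_le (n := ∞) (by simp)
  have : IsManifold 𝓘(ℝ, E') 1 P := IsManifold.of_le (n := ∞) (by simp)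
  set χ := extChartAt (powModel E s) q
  set ξ := extChartAt 𝓘(ℝ, E') p₀
  set c : (Fin s → E) →L[ℝ] (Fin s → E) :=
    mfderiv (powModel E s) 𝓘(ℝ, Fin s → E) χ (f p)
  have hc : HasMFDerivAt (powModel E s) 𝓘(ℝ, Fin s → E) χ (f p) c :=
    (mdifferentiableAt_extChartAt (by
      rw [← extChartAt_source (powModel E s)]
      exact hq)).hasMFDerivAt
  have hcinj : Function.Injective c := (isInvertible_mfderiv_extChartAt hq).injective
  have hξp : ξ.symm (ξ p) = p := ξ.left_inv hp
  have hξd : MDifferentiableAt 𝓘(ℝ, E') 𝓘(ℝ, E') ξ.symm (ξ p) :=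
    ((contMDiffOn_extChartAt_symm (n := 1) p₀).contMDiffAt
      ((isOpen_extChartAt_target p₀).mem_nhds (ξ.map_source hp))).mdifferentiableAt (by simp)
  set d : E' →L[ℝ] E' := mfderiv 𝓘(ℝ, E') 𝓘(ℝ, E') ξ.symm (ξ p)
  set f' : E' →L[ℝ] (Fin s → E) := mfderiv 𝓘(ℝ, E') (powModel E s) f p
  have h1 : HasFDerivAt (fun x => χ (f (ξ.symm x))) (c.comp (f'.comp d)) (ξ p) := by
    have hd : HasMFDerivAt 𝓘(ℝ, E') 𝓘(ℝ, E') ξ.symm (ξ p) d := hξd.hasMFDerivAt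
    have hf1 : HasMFDerivAt 𝓘(ℝ, E') (powModel E s) f (ξ.symm (ξ p)) f' := by
      rw [hξp]
      exact hf.hasMFDerivAt
    have hc1 : HasMFDerivAt (powModel E s) 𝓘(ℝ, Fin s → E) χ (f (ξ.symm (ξ p))) c := by
      rw [hξp]
      exact hc
    exact (HasMFDerivAt.comp (ξ p) hc1 (HasMFDerivAt.comp (ξ p) hf1 hd)).hasFDerivAt
  have hσd : MDifferentiableAt 𝓘(ℝ, V) (powModel E s) σ v :=
    (hσ.contMDiffAt (hW.mem_nhds hv)).mdifferentiableAt (by simp)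
  set σ' : V →L[ℝ] (Fin s → E) := mfderiv 𝓘(ℝ, V) (powModel E s) σ v
  have hσ' : HasMFDerivAt 𝓘(ℝ, V) (powModel E s) σ v σ' := hσd.hasMFDerivAt
  have h2 : HasFDerivAt (fun x => χ (σ x)) (c.comp σ') v := by
    have hc1 : HasMFDerivAt (powModel E s) 𝓘(ℝ, Fin s → E) χ (σ v) c := by
      rw [← hpv]
      exact hc
    exact (HasMFDerivAt.comp v hc1 hσ').hasFDerivAt
  have h1' : HasFDerivAt (fun x : E' × V => χ (f (ξ.symm x.1)))
      ((c.comp (f'.comp d)).comp (ContinuousLinearMap.fst ℝ E' V)) (ξ p, v) :=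
    HasFDerivAt.comp (f := Prod.fst) (ξ p, v) h1 hasFDerivAt_fst
  have h2' : HasFDerivAt (fun x : E' × V => χ (σ x.2))
      ((c.comp σ').comp (ContinuousLinearMap.snd ℝ E' V)) (ξ p, v) :=
    HasFDerivAt.comp (f := Prod.snd) (ξ p, v) h2 hasFDerivAt_snd
  have hAeq := hder.unique (h1'.sub h2')
  refine eq_univ_of_forall fun w => ?_
  -- In the chart `χ` the equation reads `c (f' (d α)) - c (σ' β) = c w`, and `c` is injective. The
  -- vector `σ' (-β)` is tangent to `R` as the velocity of the image under `σ` of a straight line.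
  obtain ⟨⟨α, β⟩, hαβ⟩ := hA (c w)
  rw [hAeq] at hαβ
  have hw : (w : Fin s → E) = f' (d α) + σ' (-β) := by
    apply hcinj
    rw [← hαβ, map_add, map_neg, map_neg, ← sub_eq_add_neg]
    rfl
  obtain ⟨ε, hε, hball⟩ : ∃ ε : ℝ, 0 < ε ∧ ∀ t ∈ Ioo (-ε) ε, v + t • (-β) ∈ W := by
    have hcont : Continuous fun t : ℝ => v + t • (-β) := by fun_prop
    obtain ⟨ε, hε, h⟩ := Metric.mem_nhds_iff.1
      ((hW.preimage hcont).mem_nhds (x := 0) (by simpa using hv))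
    refine ⟨ε, hε, fun t ht => h ?_⟩
    rw [Real.ball_eq_Ioo]
    simpa using ht
  have hline : ContDiff ℝ ∞ fun t : ℝ => v + t • (-β) := by fun_prop
  have hlined : HasFDerivAt (fun t : ℝ => v + t • (-β))
      (ContinuousLinearMap.toSpanSingleton ℝ (-β)) 0 :=
    (ContinuousLinearMap.toSpanSingleton ℝ (-β)).hasFDerivAt.const_add v
  have hγ0 : (fun t : ℝ => σ (v + t • (-β))) 0 = f p := by simp [hpv]
  have hγd : mfderiv 𝓘(ℝ, ℝ) (powModel E s) (fun t : ℝ => σ (v + t • (-β))) 0 (1 : ℝ) =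
      σ' (-β) := by
    have h3 : HasMFDerivAt 𝓘(ℝ, V) (powModel E s) σ (v + (0 : ℝ) • (-β)) σ' := by
      rw [zero_smul, add_zero]
      exact hσ'
    exact (DFunLike.congr_fun (HasMFDerivAt.comp (0 : ℝ) h3 hlined.hasMFDerivAt).mfderiv
      (1 : ℝ)).trans (congrArg σ' (one_smul ℝ (-β)))
  refine Set.mem_add.2 ⟨f' (d α), ⟨d α, rfl⟩, σ' (-β), mem_tangentVectors hε
    (hσ.comp hline.contMDiff.contMDiffOn hball) (fun t ht => hσR (hball t ht)) hγ0 hγd, hw.symm⟩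

/-- Near a given pair of points, transversality holds for an open and dense set of parameters. -/
theorem IsDiffFamily.exists_isOpen_dense_transverse [FiniteDimensional ℝ E] [T2Space L]
    [FiniteDimensional ℝ E'] {φ : B → L → L} {O : Set B}
    (h : IsDiffFamily E φ O univ) {N : Set (Fin s → L)} (hN : IsSubmanifold (powModel E s) N)
    (hNd : N ⊆ (bigDiagonal L s)ᶜ) {f : P → Fin s → L}
    (hf : ContMDiff 𝓘(ℝ, E') (powModel E s) ∞ f) (p₀ : P) {y₀ : Fin s → L} (hy₀ : y₀ ∈ N) :
    ∃ A ⊆ O, IsOpen A ∧ O ⊆ closure A ∧ ∃ Q ∈ 𝓝[univ ×ˢ N] (p₀, y₀), ∀ b ∈ A, ∀ z ∈ Q,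
      z.2 ∈ N → f z.1 = powMap s (φ b) z.2 →
        Set.range (mfderiv 𝓘(ℝ, E') (powModel E s) f z.1) +
          tangentVectors (powModel E s) (powMap s (φ b) '' N) (f z.1) = Set.univ := by
  have : IsManifold (powModel E s) ∞ (Fin s → L) := isManifold_pow
  have : (powModel E s).Boundaryless := powModel_boundaryless E s
  have : ProperSpace E' := FiniteDimensional.proper_real E'
  obtain ⟨k, hk⟩ := hN
  obtain ⟨e, he, hye, V, -, hV⟩ := hk y₀ hy₀
  have : ProperSpace V := FiniteDimensional.proper_real V
  set χ := extChartAt (powModel E s) (f p₀)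
  set ξ := extChartAt 𝓘(ℝ, E') p₀
  set η := e.extend (powModel E s)
  have hηs : η.source = e.source := e.extend_source
  set v₀ : V := ⟨η y₀, (hV y₀ hye).1 hy₀⟩
  set σ : V → Fin s → L := fun v => η.symm v
  set W : Set V := (fun v : V => (v : Fin s → E)) ⁻¹' η.target
  have hηo : IsOpen η.target := e.isOpen_extend_target
  have hW : IsOpen W := hηo.preimage continuous_subtype_val
  have hv₀ : v₀ ∈ W := η.map_source (hηs ▸ hye)
  have hσ : ContMDiffOn 𝓘(ℝ, V) (powModel E s) ∞ σ W := by
    have h1 : ContMDiffOn 𝓘(ℝ, Fin s → E) (powModel E s) ∞ η.symm η.target :=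
      (contMDiffOn_extend_symm he).mono (by rw [e.extend_target'])
    exact h1.comp V.subtypeL.contDiff.contMDiff.contMDiffOn fun v hv => hv
  have hσN : MapsTo σ W N := fun v hv => by
    have h1 : η.symm v ∈ e.source := hηs ▸ η.map_target hv
    refine (hV _ h1).2 ?_
    rw [η.right_inv hv]
    exact v.2
  set Px : Set E' := ξ.target ∩ (fun x => f (ξ.symm x)) ⁻¹' χ.source
  have hfξ : ContMDiffOn 𝓘(ℝ, E') (powModel E s) ∞ (fun x => f (ξ.symm x)) ξ.target :=
    hf.comp_contMDiffOn (contMDiffOn_extChartAt_symm p₀)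
  have hPx : IsOpen Px := hfξ.continuousOn.isOpen_inter_preimage (isOpen_extChartAt_target p₀)
    (isOpen_extChartAt_source _)
  have hp₀ : ξ p₀ ∈ Px := by
    refine ⟨mem_extChartAt_target p₀, ?_⟩
    change f (ξ.symm (ξ p₀)) ∈ χ.source
    rw [ξ.left_inv (mem_extChartAt_source p₀)]
    exact mem_extChartAt_source _
  obtain ⟨C₁, hC₁, hpC₁, hC₁P⟩ := exists_compact_subset hPx hp₀
  obtain ⟨C₂, hC₂, hvC₂, hC₂W⟩ := exists_compact_subset hW hv₀
  set D : Set (B × (E' × V)) := O ×ˢ (Px ×ˢ W)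
  have hD : IsOpen D := h.isOpen.prod (hPx.prod hW)
  set f₁ : B × (E' × V) → Fin s → L := fun z => f (ξ.symm z.2.1)
  set f₂ : B × (E' × V) → Fin s → L := fun z => powMap s (φ z.1) (σ z.2.2)
  have hf₁ : ContMDiffOn 𝓘(ℝ, B × (E' × V)) (powModel E s) ∞ f₁ D := by
    have h1 : ContDiff ℝ ∞ (fun z : B × (E' × V) => z.2.1) := by fun_prop
    exact hfξ.comp h1.contMDiff.contMDiffOn fun z hz => hz.2.1.1
  have hf₂ : ContMDiffOn 𝓘(ℝ, B × (E' × V)) (powModel E s) ∞ f₂ D := by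
    have h1 : ContDiff ℝ ∞ (fun z : B × (E' × V) => (z.1, z.2.2)) := by fun_prop
    exact (h.contMDiffOn_powMap hσ hW).comp h1.contMDiff.contMDiffOn fun z hz => ⟨hz.1, hz.2.2⟩
  set Ω : Set (B × (E' × V)) := D ∩ f₂ ⁻¹' χ.source
  have hΩ : IsOpen Ω := hf₂.continuousOn.isOpen_inter_preimage hD (isOpen_extChartAt_source _)
  set G : B × (E' × V) → Fin s → E := fun z => χ (f₁ z) - χ (f₂ z)
  have hχ : ContMDiffOn (powModel E s) 𝓘(ℝ, Fin s → E) ∞ χ χ.source := by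
    have h1 := contMDiffOn_extChartAt (I := powModel E s) (n := ∞) (x := f p₀)
    rwa [← extChartAt_source (powModel E s)] at h1
  have hG : ContDiffOn ℝ ∞ G Ω := by
    have h1 : ContDiffOn ℝ ∞ (fun z => χ (f₁ z)) Ω := by
      rw [← contMDiffOn_iff_contDiffOn]
      exact hχ.comp (hf₁.mono inter_subset_left) fun z hz => hz.1.2.1.2
    have h2 : ContDiffOn ℝ ∞ (fun z => χ (f₂ z)) Ω := by
      rw [← contMDiffOn_iff_contDiffOn]
      exact hχ.comp (hf₂.mono inter_subset_left) fun z hz => hz.2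
    exact h1.sub h2
  have hCD : ∀ b ∈ O, ∀ x ∈ C₁ ×ˢ C₂, (b, x) ∈ D := fun b hb x hx =>
    ⟨hb, hC₁P hx.1, hC₂W hx.2⟩
  have hZΩ : ∀ b ∈ O, ∀ x ∈ C₁ ×ˢ C₂, (b, x) ∈ {z | f₁ z = f₂ z} → (b, x) ∈ Ω := by
    intro b hb x hx hz
    refine ⟨hCD b hb x hx, ?_⟩
    rw [mem_preimage, ← hz]
    exact (hC₁P hx.1).2
  have hGd : ∀ z ∈ Ω, HasFDerivAt G (fderiv ℝ G z) z := fun z hz =>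
    ((hG.contDiffAt (hΩ.mem_nhds hz)).differentiableAt (by simp)).hasFDerivAt
  -- `Z` is the coincidence set in `L^s`, not the zero set of `G`: it makes sense also where `f₂`
  -- leaves the chart `χ`, and it is relatively closed in `D` because `L` is Hausdorff.
  obtain ⟨A, hAO, hAo, hAd, hA⟩ := exists_isOpen_dense_regular h.isOpen (hC₁.prod hC₂) hΩ hG
    (Z := {z | f₁ z = f₂ z})
    (fun b hb x hx hz => by
      have hDn := hD.mem_nhds (hCD b hb x hx)
      exact ((hf₁.continuousOn.continuousAt hDn).prodMk
        (hf₂.continuousOn.continuousAt hDn)).preimage_mem_nhds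
          (isClosed_diagonal.isOpen_compl.mem_nhds hz))
    hZΩ
    (fun z _ hz => by
      have hz' : f₁ z = f₂ z := hz
      simp only [G, hz', sub_self])
    (fun b hb x hx hz => by
      have hzΩ := hZΩ b hb x hx hz
      have hinj : Function.Injective (σ x.2) := by
        intro i j hij
        by_contra hne
        exact hNd (hσN (hC₂W hx.2)) ⟨i, j, hne, hij⟩
      obtain ⟨A, hA, hAd⟩ := h.exists_hasFDerivAt_pow hb hinj (f p₀) hzΩ.2
      have h1 : HasFDerivAt (fun b' => G (b', x))
          ((fderiv ℝ G (b, x)).comp (ContinuousLinearMap.inl ℝ B (E' × V))) b :=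
        HasFDerivAt.comp (g := G) b (hGd _ hzΩ) (hasFDerivAt_prodMk_left b x)
      have h2 : HasFDerivAt (fun b' => G (b', x)) (-A) b := hAd.const_sub (χ (f (ξ.symm x.1)))
      rw [h1.unique h2]
      intro y
      obtain ⟨v, hv⟩ := hA (-y)
      exact ⟨v, by rw [neg_apply, hv, neg_neg]⟩)
  -- This is a neighbourhood only within `univ ×ˢ N`: the coordinates `η z.2` lie in `V` just for
  -- `z.2 ∈ N`.
  refine ⟨A, hAO, hAo, hAd, {z | z.1 ∈ ξ.source ∧ ξ z.1 ∈ C₁ ∧ z.2 ∈ e.source ∧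
    ∃ v ∈ C₂, (v : Fin s → E) = η z.2}, ?_, ?_⟩
  · obtain ⟨U, hU, hUC⟩ := mem_nhds_induced _ _ _ |>.1 (mem_interior_iff_mem_nhds.1 hvC₂)
    have hc₁ : ContinuousAt (fun z : P × (Fin s → L) => ξ z.1) (p₀, y₀) :=
      ContinuousAt.comp (f := Prod.fst) (x := (p₀, y₀)) (continuousAt_extChartAt p₀)
        continuousAt_fst
    have hc₂ : ContinuousAt (fun z : P × (Fin s → L) => η z.2) (p₀, y₀) :=
      ContinuousAt.comp (f := Prod.snd) (x := (p₀, y₀)) (e.continuousAt_extend hye)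
        continuousAt_snd
    have n₁ : ∀ᶠ z : P × (Fin s → L) in 𝓝 (p₀, y₀), z.1 ∈ ξ.source :=
      continuousAt_fst.preimage_mem_nhds (extChartAt_source_mem_nhds p₀)
    have n₂ : ∀ᶠ z : P × (Fin s → L) in 𝓝 (p₀, y₀), ξ z.1 ∈ C₁ :=
      hc₁.preimage_mem_nhds (mem_interior_iff_mem_nhds.1 hpC₁)
    have n₃ : ∀ᶠ z : P × (Fin s → L) in 𝓝 (p₀, y₀), z.2 ∈ e.source :=
      continuousAt_snd.preimage_mem_nhds (e.open_source.mem_nhds hye)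
    have n₄ : ∀ᶠ z : P × (Fin s → L) in 𝓝 (p₀, y₀), η z.2 ∈ U :=
      hc₂.preimage_mem_nhds hU
    filter_upwards [mem_nhdsWithin_of_mem_nhds n₁, mem_nhdsWithin_of_mem_nhds n₂,
      mem_nhdsWithin_of_mem_nhds n₃, mem_nhdsWithin_of_mem_nhds n₄, self_mem_nhdsWithin]
      with z h1 h2 h3 h4 h5
    exact ⟨h1, h2, h3, ⟨η z.2, (hV _ h3).1 h5.2⟩, hUC h4, rfl⟩
  · rintro b hbA ⟨p, y⟩ ⟨hp, hpC, hye', v, hvC, hvy⟩ hyN hfp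
    have hb := hAO hbA
    have hσv : σ v = y := by
      simp only [σ, hvy]
      exact η.left_inv (hηs ▸ hye')
    have hξp : ξ.symm (ξ p) = p := ξ.left_inv hp
    have hx : (ξ p, v) ∈ C₁ ×ˢ C₂ := ⟨hpC, hvC⟩
    have hz : f₁ (b, (ξ p, v)) = f₂ (b, (ξ p, v)) := by
      simp only [f₁, f₂, hξp, hσv]
      exact hfp
    have hzΩ := hZΩ b hb _ hx hz
    have hder : HasFDerivAt (fun x : E' × V => G (b, x))
        ((fderiv ℝ G (b, (ξ p, v))).comp (ContinuousLinearMap.inr ℝ B (E' × V))) (ξ p, v) :=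
      HasFDerivAt.comp (g := G) (ξ p, v) (hGd _ hzΩ) (hasFDerivAt_prodMk_right b (ξ p, v))
    have hσb : ContMDiffOn 𝓘(ℝ, V) (powModel E s) ∞ (fun v => powMap s (φ b) (σ v)) W :=
      (h.contMDiffOn_powMap hσ hW).comp
        (contDiff_const.prodMk contDiff_id : ContDiff ℝ ∞ fun v : V => (b, v)).contMDiff.contMDiffOn
        fun v hv => ⟨hb, hv⟩
    refine range_mfderiv_add_tangentVectors_eq_univ (hf.mdifferentiable (by simp) p) hW hσb
      (fun v hv => mem_image_of_mem _ (hσN hv)) (hC₂W hvC) (hfp.trans (by rw [hσv]))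
      (q := f p₀) ?_ hp (hA b hbA _ hx hz) hder
    have := (hC₁P hpC).2
    rwa [mem_preimage, hξp] at this

end LocalTransversality

end DiffTop

/-! ### Conclusion by Baire category -/

theorem mainTheorem10
    (n : ℕ) {L : Type*} [TopologicalSpace L] [ChartedSpace (EuclideanSpace ℝ (Fin n)) L]
    [IsManifold (𝓡 n) ∞ L] [CompactSpace L] [T2Space L]
    {ι : Type*} [Countable ι]
    (m : ι → ℕ) (M : ι → Type*) [∀ j, TopologicalSpace (M j)]
    [∀ j, ChartedSpace (EuclideanSpace ℝ (Fin (m j))) (M j)]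
    [∀ j, IsManifold (𝓡 (m j)) ∞ (M j)]
    [∀ j, T2Space (M j)] [∀ j, SecondCountableTopology (M j)]
    (s : ι → ℕ) (hs : ∀ j, 0 < s j)
    (N : ∀ j, Set (Fin (s j) → L))
    (hN : ∀ j, DiffTop.IsSubmanifold (ModelWithCorners.pi fun _ : Fin (s j) => 𝓡 n) (N j))
    (hNdiag : ∀ j, N j ⊆ (DiffTop.bigDiagonal L (s j))ᶜ)
    (f : ∀ j, M j → Fin (s j) → L)
    (hf : ∀ j, ContMDiff (𝓡 (m j)) (ModelWithCorners.pi fun _ : Fin (s j) => 𝓡 n) ∞ (f j))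
    (𝒰 : Set C^∞⟮𝓡 n, L; 𝓡 n, L⟯) (h𝒰 : IsOpen[DiffTop.smoothTopology L L] 𝒰)
    (hid : ContMDiffMap.id ∈ 𝒰) :
    ∃ φ : L ≃ₘ⟮𝓡 n, 𝓡 n⟯ L, φ.toContMDiffMap ∈ 𝒰 ∧
      ∀ j, DiffTop.IsTransverse (ModelWithCorners.pi fun _ : Fin (s j) => 𝓡 n) (𝓡 (m j))
        (f j) (DiffTop.powMap (s j) φ '' N j) := by
  have : SecondCountableTopology L :=
    ChartedSpace.secondCountable_of_sigmaCompact (EuclideanSpace ℝ (Fin n)) L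
  obtain ⟨B, _, _, _, φ, O, h⟩ := DiffTop.exists_isDiffFamily_univ (EuclideanSpace ℝ (Fin n)) L
  have hloc : ∀ j, ∃ c : Set (M j × (Fin (s j) → L)), c.Countable ∧
      ∃ A : M j × (Fin (s j) → L) → Set B,
        (∀ z ∈ c, IsOpen (A z) ∧ O ⊆ closure (A z) ∧ A z ⊆ O) ∧
        ∀ b, (∀ z ∈ c, b ∈ A z) → DiffTop.IsTransverse
          (ModelWithCorners.pi fun _ : Fin (s j) => 𝓡 n) (𝓡 (m j)) (f j)
          (DiffTop.powMap (s j) (φ b) '' N j) := by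
    intro j
    have hex : ∀ z ∈ (univ : Set (M j)) ×ˢ N j, _ := fun z hz =>
      h.exists_isOpen_dense_transverse (hN j) (hNdiag j) (hf j) z.1 hz.2
    choose! A hAO hAo hAd Q hQ hAQ using hex
    -- Second countability of `M j` and `L` reduces transversality to countably many local
    -- conditions.
    obtain ⟨c, hcN, hc, hcov⟩ := TopologicalSpace.countable_cover_nhdsWithin hQ
    refine ⟨c, hc, A, fun z hz => ⟨hAo z (hcN hz), hAd z (hcN hz), hAO z (hcN hz)⟩, ?_⟩
    rintro b hb p ⟨y, hy, hpy⟩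
    obtain ⟨z, hzc, hz⟩ := mem_iUnion₂.1 (hcov (mk_mem_prod (mem_univ p) hy))
    exact hAQ z (hcN hzc) b (hb z hzc) (p, y) hz hy hpy.symm
  choose c hc A hA htrans using hloc
  have : ∀ j, Countable (c j) := fun j => (hc j).to_subtype
  -- The good sets are dense only in `O`. Adjoining the exterior of `O` makes them dense in the
  -- complete space `B`, as Baire's theorem needs.
  have hdense : Dense (⋂ i : Σ j, c j, A i.1 i.2 ∪ (closure O)ᶜ) := by
    refine dense_iInter_of_isOpen (fun i => ?_) fun i => ?_
    · exact (hA i.1 i.2 i.2.2).1.union isClosed_closure.isOpen_compl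
    · rw [dense_iff_closure_eq, eq_univ_iff_forall]
      intro b
      by_cases hb : b ∈ closure O
      · exact closure_mono subset_union_left
          (closure_minimal (hA i.1 i.2 i.2.2).2.1 isClosed_closure hb)
      · exact subset_closure (Or.inr hb)
  obtain ⟨V, hV, hVo, hV0⟩ := _root_.mem_nhds_iff.1 (h.eventually_mem h𝒰 hid)
  obtain ⟨b, ⟨hbO, hbV⟩, hb⟩ := hdense.inter_open_nonempty (O ∩ V) (h.isOpen.inter hVo)
    ⟨0, h.zero_mem, hV0⟩
  obtain ⟨ψ, hψ⟩ := h.exists_diffeomorph b hbO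
  refine ⟨ψ, hV hbV _ hψ, fun j => ?_⟩
  rw [hψ]
  refine htrans j b fun z hz => ?_
  rcases mem_iInter.1 hb ⟨j, z, hz⟩ with h1 | h1
  · exact h1
  · exact absurd (subset_closure hbO) h1
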